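/- Let $X_0,X_1,\dots$ be a time-homogeneous Markov chain on $\{0,1\}$ with transition matrix $P=\begin{pmatrix}1-p_{01}&p_{01}\\p_{10}&1-p_{10}\end{pmatrix}$, $p_{01},p_{10}\ge 0$, in steady state, i.e. $(1-p,p)P=(1-p,p)$ where $p=\mathbb P(X_k=1)$. Let $(c_k^0)_{k\ge 0}$ and $(c_k^1)_{k\ge 0}$ be two sequences of i.i.d. non-negative real random variables, the chain and the two sequences being mutually independent. Put $c_k=(1-X_k)c_k^0+X_kc_k^1$ and $S(s,t)=\sum_{k=s}^{t-1}c_k$ for integers $0\le s\le t$ (the two-state Markov-modulated service process). For bivariate functions with values in $[0,\infty]$ let $f\otimes g(s,t)=\min_{s\le\tau\le t}\{f(s,\tau)+g(\tau,t)\}$, let $\delta(s,t)=0$ for $s\ge t$ and $\delta(s,t)=\infty$ for $s<t$, put $f^{(0)}=\delta$, $f^{(n+1)}=f^{(n)}\otimes f$, and $f^*=\inf_{n\ge 0}f^{(n)}$. For a window size $w>0$ (real) and a feedback delay $d\ge 1$ (integer) let $\delta_d(s,t)=\delta(s,t-d)$, let $\delta^{+w}(s,t)=w$ for $s\ge t$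 and $\delta^{+w}(s,t)=\infty$ for $s<t$, and let the service process of the feedback system be $S_{\rm win}=(S\otimes\delta_d\otimes\delta^{+w})^*\otimes S$. For a bivariate random process $Y$ write $M_Y(\theta,s,t)=E[e^{\theta Y(s,t)}]$, and for $\theta>0$ define its effective capacity as $\gamma_Y(-\theta)=\lim_{t\to\infty}-\frac1{\theta t}\log M_Y(-\theta,0,t)$. Write $\gamma_{\rm win}=\gamma_{S_{\rm win}}$. Suppose $p_{01}+p_{10}<1$, and let $\theta>0$. Then the matrix $$L(-\theta)=P\begin{pmatrix}M_{c^0}(-\theta)&0\\0&M_{c^1}(-\theta)\end{pmatrix},\qquad M_{c^i}(-\theta)=E[e^{-\theta c_0^i}],$$ has a largest eigenvalue $m_+(-\theta)$, which is positive, and $$M_{S_{\rm win}}(-\theta,s,t)\le\left(m_+(-\theta)^d+d\,e^{-\theta w}\right)^{\lfloor (t-s)/d\rfloor}\qquad(0\le s\le t).$$ Moreover, the effective capacity $\gamma_{\rm win}(-\theta)$ exists and satisfies $$\gamma_{\rm win}(-\theta)\ \ge\ \gamma_S(-\theta)-\frac1{d\theta}\log\left(1+d\,e^{\theta(d\gamma_S(-\theta)-w)}\right)\quad\text{with}\quad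 \gamma_S(-\theta)=-\frac1\theta\log m_+(-\theta),$$ and, if $0<p<1$, the number $\gamma_S(-\theta)=-\frac1\theta\log m_+(-\theta)$ is the effective capacity of the service process $S$. -/

import Mathlib

open MeasureTheory ProbabilityTheory Filter Topology
open scoped NNReal ENNReal

namespace WindowFlow

/-! Bivariate network calculus in discrete time `0, 1, 2, …`. Bivariate functions are nonnegative
and may take the value `∞`; only the values at pairs `s ≤ t` are meaningful. -/

/-- Bivariate functions `f (s, t)` with values in `[0, ∞]`. -/
abbrev Bivariate : Type := ℕ → ℕ → ℝ≥0∞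

/-- Convolution: `(f ⊗ g) (s, t) = min_{s ≤ τ ≤ t} (f (s, τ) + g (τ, t))`. -/
noncomputable def conv (f g : Bivariate) : Bivariate :=
  fun s t => (Finset.Icc s t).inf fun τ => f s τ + g τ t

/-- The neutral element `δ` of the convolution: `0` if `s ≥ t` and `∞` if `s < t`. -/
noncomputable def delta : Bivariate :=
  fun s t => if t ≤ s then 0 else ∞

/-- The delay element `δ_d (s, t) = δ (s, t - d)`, where `t - d` is the integer difference. -/
noncomputable def delay (d : ℕ) : Bivariate :=
  fun s t => if t ≤ s + d then 0 else ∞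

/-- The window element `δ^{+w}`: `w` if `s ≥ t` and `∞` if `s < t`. -/
noncomputable def window (w : ℝ≥0) : Bivariate :=
  fun s t => if t ≤ s then (w : ℝ≥0∞) else ∞

/-- Convolution powers: `f^(0) = δ` and `f^(n+1) = f^(n) ⊗ f`. Since `δ` is neutral,
`f^(1) = f` at all pairs `s ≤ t`. -/
noncomputable def convPow (f : Bivariate) : ℕ → Bivariate
  | 0 => delta
  | n + 1 => conv (convPow f n) f

/-- Subadditive closure: the infimum of all convolution powers of `f`. -/
noncomputable def closure (f : Bivariate) : Bivariate :=
  fun s t => ⨅ n : ℕ, convPow f n s t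

/-- The equivalent service process `(S ⊗ δ_d ⊗ δ^{+w})^* ⊗ S` of the feedback system with
window size `w` and feedback delay `d`. -/
noncomputable def feedbackService (d : ℕ) (w : ℝ≥0) (S : Bivariate) : Bivariate :=
  conv (closure (conv (conv S (delay d)) (window w))) S

/-- The additive service process `S (s, t) = ∑_{k = s}^{t - 1} c_k`. -/
noncomputable def additiveService (c : ℕ → ℝ≥0) : Bivariate :=
  fun s t => ((∑ k ∈ Finset.Ico s t, c k : ℝ≥0) : ℝ≥0∞)

section Stochastic

variable {Ω : Type*} [MeasurableSpace Ω]

/-- Moment-generating function `M_Y (θ, s, t) = E[exp (θ Y (s, t))]` of a bivariate random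
process `Y` whose values at pairs `s ≤ t` are finite. -/
noncomputable def bivariateMGF (μ : Measure Ω) (Y : Ω → Bivariate) (θ : ℝ) (s t : ℕ) : ℝ :=
  mgf (fun ω => (Y ω s t).toReal) μ θ

/-- `γ` is the effective capacity `γ_Y (-θ)` of the bivariate random process `Y`: the limit as
`t → ∞` of `-(1 / (θ t)) log M_Y (-θ, 0, t)` exists and equals `γ`. -/
def HasEffectiveCapacity (μ : Measure Ω) (Y : Ω → Bivariate) (θ γ : ℝ) : Prop :=
  Tendsto (fun t : ℕ => -(1 / (θ * (t : ℝ))) * Real.log (bivariateMGF μ Y (-θ) 0 t))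
    atTop (𝓝 γ)

/-- Transition matrix of the two-state chain with `p₀₀ = 1 - p₀₁` and `p₁₁ = 1 - p₁₀`. -/
def transitionMatrix (p01 p10 : ℝ) : Matrix (Fin 2) (Fin 2) ℝ :=
  !![1 - p01, p01; p10, 1 - p10]

/-- `X` is a time-homogeneous two-state Markov chain in steady state: the distribution
`(1 - p, p)` is invariant under the transition matrix, and the finite-dimensional distributions
are those of the Markov chain with this initial distribution and transition matrix. -/
structure IsStationaryTwoStateChain (μ : Measure Ω) (X : ℕ → Ω → Fin 2) (p01 p10 p : ℝ) :
    Prop where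
  measurable : ∀ k, Measurable (X k)
  invariant : Matrix.vecMul ![1 - p, p] (transitionMatrix p01 p10) = ![1 - p, p]
  law : ∀ (n : ℕ) (x : ℕ → Fin 2),
    μ.real {ω | ∀ k ≤ n, X k ω = x k} =
      ![1 - p, p] (x 0) * ∏ k ∈ Finset.range n, transitionMatrix p01 p10 (x k) (x (k + 1))

/-- The nonnegative random variables `c k`, `k = 0, 1, 2, …`, are independent and identically
distributed. -/
structure IsIIDSequence (μ : Measure Ω) (c : ℕ → Ω → ℝ≥0) : Prop where
  measurable : ∀ k, Measurable (c k)
  indep : iIndepFun c μ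
  identDistrib : ∀ k, IdentDistrib (c k) (c 0) μ μ

/-- Data of a two-state Markov-modulated service: a stationary two-state chain `X` and two
i.i.d. sequences `c0`, `c1`, such that the chain and the two sequences are mutually
independent. -/
structure IsMarkovModulated (μ : Measure Ω) (X : ℕ → Ω → Fin 2) (c0 c1 : ℕ → Ω → ℝ≥0)
    (p01 p10 p : ℝ) : Prop where
  chain : IsStationaryTwoStateChain μ X p01 p10 p
  iid0 : IsIIDSequence μ c0
  iid1 : IsIIDSequence μ c1
  indep_seq : IndepFun (fun ω k => c0 k ω) (fun ω k => c1 k ω) μ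
  indep_chain : IndepFun (fun ω k => X k ω) (fun ω => (fun k => c0 k ω, fun k => c1 k ω)) μ

/-- The service rate `c_k = (1 - X_k) c_k^0 + X_k c_k^1`. -/
def modulatedRate (X : ℕ → Ω → Fin 2) (c0 c1 : ℕ → Ω → ℝ≥0) (ω : Ω) (k : ℕ) : ℝ≥0 :=
  if X k ω = 1 then c1 k ω else c0 k ω

/-- The two-state Markov-modulated service process. -/
noncomputable def modulatedService (X : ℕ → Ω → Fin 2) (c0 c1 : ℕ → Ω → ℝ≥0) (ω : Ω) :
    Bivariate :=
  additiveService (modulatedRate X c0 c1 ω)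

/-- The matrix `L (θ) = P · diag (M_{c⁰} (θ), M_{c¹} (θ))`. -/
noncomputable def modulatedMatrix (μ : Measure Ω) (c0 c1 : ℕ → Ω → ℝ≥0) (p01 p10 θ : ℝ) :
    Matrix (Fin 2) (Fin 2) ℝ :=
  transitionMatrix p01 p10 *
    Matrix.diagonal ![mgf (fun ω => (c0 0 ω : ℝ)) μ θ, mgf (fun ω => (c1 0 ω : ℝ)) μ θ]

end Stochastic

/-- `m` is the largest (real) eigenvalue of the matrix `L`. -/
def IsLargestEigenvalue (L : Matrix (Fin 2) (Fin 2) ℝ) (m : ℝ) : Prop :=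
  IsGreatest {x : ℝ | Module.End.HasEigenvalue (Matrix.toLin' L) x} m

end WindowFlow

namespace WindowFlow

/-! Each loop of the closure costs `w` and skips at most `d` slots, so the feedback service is the
value of a shortest-path recursion: cross one slot at its rate, or skip up to `d` slots for `w`
(`feedbackService_eq_windowCost`). Bounding the exponential of a minimum by the sum of the two
exponentials turns it into the linear recursion `windowBound`, and grouping `d` steps gives the
factor `m ^ d + d * exp (-θ w)`. This needs that served slots, however scattered among skipped ones,
cost a factor `m` each: `E ∏_{k ∈ A} exp (-θ c_k) ≤ m ^ |A|` for every finite `A`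
(`integral_prod_le`).

That estimate is the crux. A served slot contributes the operator `P D` with `D = diag φ`, a skipped
one `P`, so one norm must suit both. A stationary two-state chain is reversible, and `l = 1 - p01 -
p10 > 0` is the second eigenvalue of `P`. Hence `l ⟨f, P⁻¹ f⟩`, in the inner product weighted by the
stationary law, is a positive semidefinite form; this is `energy`. With respect to it `P D` is
self-adjoint with seminorm at most `m`, and `P` has seminorm at most `1`. The function `1` has
energy `l`, and the squared stationary mean is at most energy over `l`, so the constants cancel.

The effective capacity of the feedback system exists by Fekete's lemma: `windowCost` is subadditive,
and conditioning on the path of the chain makes its moment-generating function supermultiplicative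
up to a constant, unless the chain almost surely never moves, when one has a mixture of two such
sequences. For `S` itself, the upper bound `m ^ t` is matched by a Perron lower bound
(`exists_le_chainMean`). -/

/-- The least cost of crossing the slots `0, …, r - 1` when slot `k` costs `c k` and any run of at
most `d` consecutive slots can be skipped at cost `w`. -/
noncomputable def windowCost (d : ℕ) (w : ℝ≥0) (c : ℕ → ℝ≥0) : ℕ → ℝ≥0
  | 0 => 0
  | r + 1 => min (windowCost d w c r + c r) (windowCost d w c (r - (d - 1)) + w)
termination_by r => r

/-! ### The shortest-path recursion -/

section windowCost

variable {d : ℕ} {w : ℝ≥0} {c : ℕ → ℝ≥0}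

@[simp] lemma windowCost_zero : windowCost d w c 0 = 0 := by rw [windowCost]

lemma windowCost_succ (r : ℕ) : windowCost d w c (r + 1) =
    min (windowCost d w c r + c r) (windowCost d w c (r - (d - 1)) + w) := by
  rw [windowCost]

lemma windowCost_succ_le_add_rate (r : ℕ) :
    windowCost d w c (r + 1) ≤ windowCost d w c r + c r := by
  rw [windowCost_succ]; exact min_le_left _ _

lemma windowCost_le_add_window (hd : 0 < d) (r : ℕ) :
    windowCost d w c r ≤ windowCost d w c (r - d) + w := by
  cases r with
  | zero => simp
  | succ r =>
    have h : r + 1 - d = r - (d - 1) := by omega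
    rw [windowCost_succ, h]; exact min_le_right _ _

/-- Serving a slot clearly does not lower the cost. If the last move is a window, the same window
move also ends at `r`, from an index that is no larger, and induction applies there. -/
lemma windowCost_le_succ (r : ℕ) : windowCost d w c r ≤ windowCost d w c (r + 1) := by
  induction r using Nat.strong_induction_on with
  | _ r ih =>
    rw [windowCost_succ r]
    refine le_min le_self_add ?_
    cases r with
    | zero => simp
    | succ r =>
      refine (windowCost_succ (d := d) (w := w) (c := c) r ▸ min_le_right _ _ :
        windowCost d w c (r + 1) ≤ windowCost d w c (r - (d - 1)) + w).trans ?_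
      gcongr
      rcases Nat.lt_or_ge r (d - 1) with h | h
      · rw [Nat.sub_eq_zero_of_le h.le]; simp
      · rw [Nat.sub_add_comm h]; exact ih _ (by omega)

lemma windowCost_mono : Monotone (windowCost d w c) :=
  monotone_nat_of_le_succ windowCost_le_succ

lemma windowCost_le_add_sum {q r : ℕ} (h : q ≤ r) :
    windowCost d w c r ≤ windowCost d w c q + ∑ k ∈ Finset.Ico q r, c k := by
  induction r, h using Nat.le_induction with
  | base => simp
  | succ r h ih =>
    rw [Finset.sum_Ico_succ_top h, ← add_assoc]
    refine (windowCost_succ_le_add_rate r).trans ?_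
    gcongr

/-- Two crossings can be concatenated. A window of the second one is cut off at its origin by
truncated subtraction, whereas in the joint crossing it may reach back before `r`; monotonicity
makes this harmless. -/
lemma windowCost_add_le (hd : 0 < d) (r q : ℕ) :
    windowCost d w c (r + q) ≤ windowCost d w c r + windowCost d w (fun k => c (r + k)) q := by
  induction q using Nat.strong_induction_on with
  | _ q ih =>
    cases q with
    | zero => simp
    | succ q =>
      rw [windowCost_succ q, ← min_add_add_left]
      refine le_min ?_ ?_
      · rw [← add_assoc, ← add_assoc]
        refine (windowCost_succ_le_add_rate (r + q)).trans ?_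
        gcongr
        exact ih q (by omega)
      · rw [← add_assoc, ← add_assoc]
        refine (windowCost_le_add_window hd _).trans ?_
        gcongr
        refine le_trans (windowCost_mono ?_) (ih (q - (d - 1)) (by omega))
        omega

lemma windowCost_congr {c' : ℕ → ℝ≥0} {r : ℕ} (h : ∀ k < r, c k = c' k) :
    windowCost d w c r = windowCost d w c' r := by
  induction r using Nat.strong_induction_on with
  | _ r ih =>
    cases r with
    | zero => simp
    | succ r =>
      rw [windowCost_succ, windowCost_succ, ih r (by omega) fun k hk => h k (by omega),
        ih (r - (d - 1)) (by omega) fun k hk => h k (by omega), h r (by omega)]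

variable (d w) in
lemma measurable_windowCost (r : ℕ) : Measurable fun c : ℕ → ℝ≥0 => windowCost d w c r := by
  induction r using Nat.strong_induction_on with
  | _ r ih =>
    cases r with
    | zero => simp
    | succ r =>
      simp only [windowCost_succ]
      exact ((ih r (by omega)).add (measurable_pi_apply r)).min
        ((ih (r - (d - 1)) (by omega)).add_const w)

end windowCost

/-! ### The feedback service equals the recursion -/

section feedbackService

variable {d : ℕ} {w : ℝ≥0} {c : ℕ → ℝ≥0}

lemma conv_le (f g : Bivariate) {s τ t : ℕ} (h₁ : s ≤ τ) (h₂ : τ ≤ t) :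
    conv f g s t ≤ f s τ + g τ t :=
  Finset.inf_le (f := fun τ => f s τ + g τ t) (Finset.mem_Icc.2 ⟨h₁, h₂⟩)

lemma le_conv {f g : Bivariate} {s t : ℕ} {a : ℝ≥0∞}
    (h : ∀ τ, s ≤ τ → τ ≤ t → a ≤ f s τ + g τ t) : a ≤ conv f g s t :=
  Finset.le_inf fun τ hτ => h τ (Finset.mem_Icc.1 hτ).1 (Finset.mem_Icc.1 hτ).2

lemma additiveService_mono_right {s t t' : ℕ} (h : t ≤ t') :
    additiveService c s t ≤ additiveService c s t' := by
  unfold additiveService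
  gcongr

lemma additiveService_self (s : ℕ) : additiveService c s s = 0 := by
  simp [additiveService]

/-- Finiteness of the window element forces the outer split point to be `t`, and that of the delay
element an inner one at least `t - d`; `S` is then least at the earliest such point. The maximum
keeps it in `[s, t]`. -/
lemma feedbackLoop_apply {s t : ℕ} (h : s ≤ t) :
    conv (conv (additiveService c) (delay d)) (window w) s t =
      additiveService c s (max s (t - d)) + w := by
  apply le_antisymm
  · refine (conv_le _ _ h le_rfl).trans ?_
    simp only [window, le_refl, if_true]
    gcongr
    refine (conv_le _ _ (τ := max s (t - d)) (by omega) (by omega)).trans ?_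
    have : t ≤ max s (t - d) + d := by omega
    simp [delay, this]
  · refine Finset.le_inf fun τ hτ => ?_
    rw [Finset.mem_Icc] at hτ
    by_cases hτt : t ≤ τ
    · obtain rfl : τ = t := by omega
      simp only [window, le_refl, if_true]
      gcongr
      refine Finset.le_inf fun σ hσ => ?_
      rw [Finset.mem_Icc] at hσ
      by_cases hσt : τ ≤ σ + d
      · refine (additiveService_mono_right ?_).trans le_self_add
        omega
      · simp [delay, hσt]
    · simp [window, hτt]

lemma windowCost_le_add_additiveService {s a b : ℕ} (hs : s ≤ a) (h : a ≤ b) :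
    (windowCost d w (fun k => c (s + k)) (b - s) : ℝ≥0∞) ≤
      windowCost d w (fun k => c (s + k)) (a - s) + additiveService c a b := by
  have h1 := windowCost_le_add_sum (d := d) (w := w) (c := fun k => c (s + k))
    (q := a - s) (r := b - s) (by omega)
  rw [Finset.sum_Ico_add c (a - s) (b - s) s, Nat.sub_add_cancel hs,
    Nat.sub_add_cancel (hs.trans h)] at h1
  unfold additiveService
  exact_mod_cast h1

lemma windowCost_le_convPow (hd : 0 < d) (n : ℕ) {s t : ℕ} (h : s ≤ t) :
    (windowCost d w (fun k => c (s + k)) (t - s) : ℝ≥0∞) ≤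
      convPow (conv (conv (additiveService c) (delay d)) (window w)) n s t := by
  induction n generalizing t with
  | zero =>
    by_cases hts : t ≤ s
    · rw [Nat.sub_eq_zero_of_le hts]; simp
    · simp [convPow, delta, hts]
  | succ n ih =>
    refine le_conv fun τ h₁ h₂ => ?_
    rw [feedbackLoop_apply h₂, ← add_assoc]
    calc (windowCost d w (fun k => c (s + k)) (t - s) : ℝ≥0∞)
        ≤ windowCost d w (fun k => c (s + k)) (max τ (t - d) - s) + w := by
          refine mod_cast (windowCost_le_add_window hd _).trans ?_
          gcongr
          exact windowCost_mono (by omega)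
      _ ≤ _ := by
          gcongr
          refine (windowCost_le_add_additiveService h₁ (le_max_left _ _)).trans ?_
          gcongr
          exact ih h₁

lemma windowCost_le_feedbackService (hd : 0 < d) (s t : ℕ) :
    (windowCost d w (fun k => c (s + k)) (t - s) : ℝ≥0∞) ≤
      feedbackService d w (additiveService c) s t := by
  refine le_conv fun τ h₁ h₂ => ?_
  refine (windowCost_le_add_additiveService h₁ h₂).trans ?_
  gcongr
  exact le_iInf fun n => windowCost_le_convPow hd n h₁

lemma closure_le_closure_add (f : Bivariate) {s τ t : ℕ} (h₁ : s ≤ τ) (h₂ : τ ≤ t) :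
    closure f s t ≤ closure f s τ + f τ t := by
  unfold closure
  rw [ENNReal.iInf_add]
  exact le_iInf fun n =>
    (iInf_le (fun n => convPow f n s t) (n + 1)).trans (conv_le _ _ h₁ h₂)

/-- An optimal split point for a shorter interval is reused: serving one more slot lengthens the
final `S`, while using a window appends one more loop to the closure. -/
lemma feedbackService_le_windowCost (hd : 0 < d) (s r : ℕ) :
    feedbackService d w (additiveService c) s (s + r) ≤
      windowCost d w (fun k => c (s + k)) r := by
  induction r using Nat.strong_induction_on with
  | _ r ih =>
    cases r with
    | zero =>
      refine (conv_le _ _ le_rfl le_rfl).trans ?_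
      refine (add_le_add (iInf_le (fun n => convPow _ n s s) 0) le_rfl).trans ?_
      simp [convPow, delta, additiveService]
    | succ r =>
      have attained : ∀ q, ∃ τ, s ≤ τ ∧ τ ≤ s + q ∧
          feedbackService d w (additiveService c) s (s + q) =
            closure (conv (conv (additiveService c) (delay d)) (window w)) s τ +
              additiveService c τ (s + q) := fun q => by
        obtain ⟨τ, hτ, e⟩ := Finset.exists_mem_eq_inf (Finset.Icc s (s + q))
          (Finset.nonempty_Icc.2 (Nat.le_add_right s q)) fun τ =>
            closure (conv (conv (additiveService c) (delay d)) (window w)) s τ +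
              additiveService c τ (s + q)
        rw [Finset.mem_Icc] at hτ
        exact ⟨τ, hτ.1, hτ.2, e⟩
      rw [windowCost_succ]
      push_cast
      refine le_min ?_ ?_
      · refine le_trans ?_ (add_le_add (ih r (by omega)) le_rfl)
        obtain ⟨τ, h₁, h₂, e⟩ := attained r
        rw [e, add_assoc]
        refine (conv_le _ _ h₁ (by omega)).trans ?_
        gcongr
        unfold additiveService
        rw [← add_assoc s r 1, Finset.sum_Ico_succ_top h₂]
        push_cast
        rfl
      · refine le_trans ?_ (add_le_add (ih (r - (d - 1)) (by omega)) le_rfl)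
        obtain ⟨τ, h₁, h₂, e⟩ := attained (r - (d - 1))
        rw [e]
        -- The new loop runs from `τ` to the end, so the final `S` is empty, and the part of `S`
        -- inside the loop ends no later than `s + (r - (d - 1))`.
        refine (conv_le _ _ (τ := s + (r + 1)) (by omega) le_rfl).trans ?_
        rw [additiveService_self, add_zero]
        refine (closure_le_closure_add _ h₁ (by omega)).trans ?_
        rw [feedbackLoop_apply (by omega), add_assoc]
        gcongr
        exact additiveService_mono_right (by omega)

lemma feedbackService_eq_windowCost (hd : 0 < d) {s t : ℕ} (h : s ≤ t) :
    feedbackService d w (additiveService c) s t =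
      windowCost d w (fun k => c (s + k)) (t - s) := by
  refine le_antisymm ?_ (windowCost_le_feedbackService hd s t)
  simpa [Nat.add_sub_cancel' h] using feedbackService_le_windowCost (c := c) hd s (t - s)

end feedbackService

/-! ### The largest eigenvalue of the modulated matrix -/

section Eigenvalue

lemma hasEigenvalue_toLin'_iff (L : Matrix (Fin 2) (Fin 2) ℝ) (x : ℝ) :
    Module.End.HasEigenvalue (Matrix.toLin' L) x ↔ x ^ 2 - L.trace * x + L.det = 0 := by
  rw [Module.End.hasEigenvalue_iff_isRoot_charpoly, Matrix.charpoly_toLin',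
    Matrix.charpoly_fin_two]
  simp [Polynomial.IsRoot]

/-- `m` is the largest eigenvalue of the matrix `P · diag (φ 0, φ 1)`, lies in `(0, 1]` and is not
exceeded by the diagonal entries. -/
structure IsPerronRoot (p01 p10 : ℝ) (φ : Fin 2 → ℝ) (m : ℝ) : Prop where
  pos : 0 < m
  le_one : m ≤ 1
  root : m ^ 2 - ((1 - p01) * φ 0 + (1 - p10) * φ 1) * m + (1 - p01 - p10) * (φ 0 * φ 1) = 0
  diag_zero : (1 - p01) * φ 0 ≤ m
  diag_one : (1 - p10) * φ 1 ≤ m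
  isLargest : IsLargestEigenvalue (transitionMatrix p01 p10 * Matrix.diagonal φ) m

lemma exists_isPerronRoot {p01 p10 : ℝ} (hp01 : 0 ≤ p01) (hp10 : 0 ≤ p10) (hp : p01 + p10 < 1)
    {φ : Fin 2 → ℝ} (hφ : ∀ i, 0 < φ i) (hφ1 : ∀ i, φ i ≤ 1) :
    ∃ m, IsPerronRoot p01 p10 φ m := by
  set a := (1 - p01) * φ 0 with ha
  set b := (1 - p10) * φ 1 with hb
  set D := (a - b) ^ 2 + 4 * (p01 * p10 * (φ 0 * φ 1)) with hD
  have hφ0 := hφ 0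
  have hφ1' := hφ 1
  have hcross : 0 ≤ p01 * p10 * (φ 0 * φ 1) := by positivity
  have hD0 : 0 ≤ D := by positivity
  have hs : √D ^ 2 = D := Real.sq_sqrt hD0
  have hab : |a - b| ≤ √D := Real.abs_le_sqrt (by linarith)
  have ha0 : 0 < a := mul_pos (by linarith) hφ0
  have hb0 : 0 < b := mul_pos (by linarith) hφ1'
  have hsub := abs_le.1 hab
  have htr : (transitionMatrix p01 p10 * Matrix.diagonal φ).trace = a + b := by
    simp [transitionMatrix, Matrix.trace_fin_two, Matrix.vecMul_diagonal, ha, hb]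
  have hdet : (transitionMatrix p01 p10 * Matrix.diagonal φ).det =
      (1 - p01 - p10) * (φ 0 * φ 1) := by
    simp [transitionMatrix, Matrix.det_fin_two, Matrix.vecMul_diagonal]
    ring
  have hroot : ((a + b + √D) / 2) ^ 2 - (a + b) * ((a + b + √D) / 2) +
      (1 - p01 - p10) * (φ 0 * φ 1) = 0 := by
    linear_combination hs / 4 + hD / 4 + a * hb + (1 - p10) * φ 1 * ha
  refine ⟨(a + b + √D) / 2, by linarith [Real.sqrt_nonneg D], ?_, hroot, by linarith,
    by linarith, ?_, ?_⟩
  · have h2 : √D ≤ 2 - (a + b) := by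
      refine Real.sqrt_le_iff.2 ⟨?_, ?_⟩
      · have : a ≤ 1 := by rw [ha]; nlinarith [hφ1 0]
        have : b ≤ 1 := by rw [hb]; nlinarith [hφ1 1]
        linarith
      -- The right-hand side is the characteristic polynomial at `1`; its nonnegativity is the
      -- squared inequality sought.
      · have h3 : 0 ≤ (1 - φ 0) * (1 - φ 1) + p01 * φ 0 * (1 - φ 1) + p10 * φ 1 * (1 - φ 0) := by
          have := sub_nonneg.2 (hφ1 0)
          have := sub_nonneg.2 (hφ1 1)
          positivity
        rw [hD, ha, hb]
        nlinarith
    linarith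
  · rw [Set.mem_ofPred_eq, hasEigenvalue_toLin'_iff, htr, hdet]
    exact hroot
  · intro x hx
    rw [Set.mem_ofPred_eq, hasEigenvalue_toLin'_iff, htr, hdet] at hx
    by_contra! hlt
    have hsq := Real.sqrt_nonneg D
    have h4 : (x - (a + b + √D) / 2) * (x - (a + b - √D) / 2) = 0 := by
      linear_combination hx - hroot
    have : 0 < (x - (a + b + √D) / 2) * (x - (a + b - √D) / 2) :=
      mul_pos (by linarith) (by linarith)
    linarith

end Eigenvalue

/-! ### The energy seminorm -/

section Contraction

/-- A quadratic form in which `P` is self-adjoint and nonexpansive. -/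
def energy (p l : ℝ) (f : Fin 2 → ℝ) : ℝ :=
  l * ((1 - p) * f 0 + p * f 1) ^ 2 + p * (1 - p) * (f 1 - f 0) ^ 2

variable {p l m : ℝ} {φ : Fin 2 → ℝ}

/-- `P` preserves the stationary mean and multiplies the deviation `f 1 - f 0` by `l`. -/
lemma energy_mulVec_le (hp0 : 0 ≤ p) (hp1 : p ≤ 1) (hl0 : 0 < l) (hl1 : l ≤ 1)
    (f : Fin 2 → ℝ) :
    energy p l ((transitionMatrix (p * (1 - l)) ((1 - p) * (1 - l))).mulVec f) ≤
      energy p l f := by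
  have h : 0 ≤ p * (1 - p) * (f 1 - f 0) ^ 2 :=
    mul_nonneg (mul_nonneg hp0 (by linarith)) (sq_nonneg _)
  have e : energy p l ((transitionMatrix (p * (1 - l)) ((1 - p) * (1 - l))).mulVec f) =
      l * ((1 - p) * f 0 + p * f 1) ^ 2 + l ^ 2 * (p * (1 - p) * (f 1 - f 0) ^ 2) := by
    simp [energy, transitionMatrix, Matrix.mulVec, dotProduct, Fin.sum_univ_two]
    ring
  rw [e, energy]
  nlinarith [pow_le_one₀ hl0.le hl1 (n := 2)]

/-- The left side is the energy inner product of `P D f` with `f`. The difference of the two sides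
is a binary quadratic form whose determinant vanishes because `m` is an eigenvalue, and whose
diagonal is nonnegative because `m` dominates the diagonal of `P D`. -/
lemma diag_form_le_energy (hp0 : 0 ≤ p) (hp1 : p ≤ 1) (hl0 : 0 < l)
    (hφ : ∀ i, 0 < φ i)
    (hm : IsPerronRoot (p * (1 - l)) ((1 - p) * (1 - l)) φ m) (f : Fin 2 → ℝ) :
    l * ((1 - p) * φ 0 * f 0 ^ 2 + p * φ 1 * f 1 ^ 2) ≤ m * energy p l f := by
  obtain ⟨q, rfl⟩ : ∃ q, p = 1 - q := ⟨1 - p, by ring⟩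
  have hq0 : 0 ≤ q := by linarith
  have hm0 := hm.pos
  have hr := hm.root
  set α := m * (l * q + (1 - q)) - l * φ 0 with hα
  set β := m * (l * (1 - q) + q) - l * φ 1 with hβ
  have hαβ : α * β = m ^ 2 * ((1 - q) * q) * (1 - l) ^ 2 := by
    rw [hα, hβ]; linear_combination l * hr
  have hα0 : 0 ≤ α := by
    -- The two sides differ by `(1 - q) * q * (1 - l) ^ 2`.
    have h1 : l ≤ (1 - (1 - q) * (1 - l)) * (l * q + (1 - q)) := by
      nlinarith [mul_nonneg (mul_nonneg hp0 hq0) (sq_nonneg (1 - l))]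
    have h2 : 0 ≤ l * q + (1 - q) := by positivity
    nlinarith [mul_le_mul_of_nonneg_right hm.diag_zero h2, mul_le_mul_of_nonneg_right h1 (hφ 0).le]
  have hβ0 : 0 ≤ β := by
    have h1 : l ≤ (1 - (1 - (1 - q)) * (1 - l)) * (l * (1 - q) + q) := by
      nlinarith [mul_nonneg (mul_nonneg hp0 hq0) (sq_nonneg (1 - l))]
    have h2 : 0 ≤ l * (1 - q) + q := by positivity
    nlinarith [mul_le_mul_of_nonneg_right hm.diag_one h2, mul_le_mul_of_nonneg_right h1 (hφ 1).le]
  have key : m * energy (1 - q) l f -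
      l * ((1 - (1 - q)) * φ 0 * f 0 ^ 2 + (1 - q) * φ 1 * f 1 ^ 2) =
      q * α * f 0 ^ 2 - 2 * (m * ((1 - q) * q) * (1 - l)) * (f 0 * f 1) +
        (1 - q) * β * f 1 ^ 2 := by
    rw [hα, hβ, energy]; ring
  suffices h : 0 ≤ q * α * f 0 ^ 2 - 2 * (m * ((1 - q) * q) * (1 - l)) * (f 0 * f 1) +
      (1 - q) * β * f 1 ^ 2 by linarith
  -- If `α = 0`, the vanishing determinant kills the mixed term; otherwise multiplication by `α`
  -- completes the square.
  rcases hα0.eq_or_lt with h0 | hpos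
  · have h1 : m * ((1 - q) * q) * (1 - l) = 0 := by
      rw [← h0, zero_mul] at hαβ
      have h2 : (m * ((1 - q) * q) * (1 - l)) ^ 2 = 0 := by
        linear_combination (-((1 - q) * q)) * hαβ
      exact pow_eq_zero_iff two_ne_zero |>.1 h2
    rw [h1, ← h0]
    have := mul_nonneg (mul_nonneg hp0 hβ0) (sq_nonneg (f 1))
    linarith
  · refine nonneg_of_mul_nonneg_right ?_ hpos
    have : α * (q * α * f 0 ^ 2 - 2 * (m * ((1 - q) * q) * (1 - l)) * (f 0 * f 1) +
        (1 - q) * β * f 1 ^ 2) = q * (α * f 0 - m * (1 - q) * (1 - l) * f 1) ^ 2 := by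
      linear_combination ((1 - q) * f 1 ^ 2) * hαβ
    rw [this]
    positivity

/-- By self-adjointness and Cayley–Hamilton for `L = P D`, the energy of `L f` is `trace L * ⟨L f,
f⟩ - det L * ⟨f, f⟩`. The previous lemma bounds `⟨L f, f⟩`, and `m` solves the same quadratic
equation. -/
lemma energy_mulVec_diagonal_le (hp0 : 0 ≤ p) (hp1 : p ≤ 1) (hl0 : 0 < l)
    (hφ : ∀ i, 0 < φ i)
    (hm : IsPerronRoot (p * (1 - l)) ((1 - p) * (1 - l)) φ m) (f : Fin 2 → ℝ) :
    energy p l ((transitionMatrix (p * (1 - l)) ((1 - p) * (1 - l))).mulVec (φ * f)) ≤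
      m ^ 2 * energy p l f := by
  have e : energy p l ((transitionMatrix (p * (1 - l)) ((1 - p) * (1 - l))).mulVec (φ * f)) =
      ((1 - p * (1 - l)) * φ 0 + (1 - (1 - p) * (1 - l)) * φ 1) *
        (l * ((1 - p) * φ 0 * f 0 ^ 2 + p * φ 1 * f 1 ^ 2)) -
        l * (φ 0 * φ 1) * energy p l f := by
    simp [energy, transitionMatrix, Matrix.mulVec, dotProduct, Fin.sum_univ_two]
    ring
  have h := diag_form_le_energy hp0 hp1 hl0 hφ hm f
  have hT : 0 ≤ (1 - p * (1 - l)) * φ 0 + (1 - (1 - p) * (1 - l)) * φ 1 := by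
    have h1 : 0 ≤ 1 - p * (1 - l) := by nlinarith
    have h2 : 0 ≤ 1 - (1 - p) * (1 - l) := by nlinarith
    have := (hφ 0).le
    have := (hφ 1).le
    positivity
  rw [e]
  have hr := hm.root
  have := mul_le_mul_of_nonneg_left h hT
  have e2 : m ^ 2 * energy p l f =
      ((1 - p * (1 - l)) * φ 0 + (1 - (1 - p) * (1 - l)) * φ 1) * (m * energy p l f) -
        l * (φ 0 * φ 1) * energy p l f := by
    linear_combination energy p l f * hr
  linarith

end Contraction

/-! ### Products along the chain -/

section ChainMean

/-- `chainMean P n ψ i` is the mean of `∏ k < n, ψ k (x k)` over the paths `x` of the Markov chain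
with transition matrix `P` whose first state `x 0` is chosen by a transition from `i`. -/
def chainMean (P : Matrix (Fin 2) (Fin 2) ℝ) : ℕ → (ℕ → Fin 2 → ℝ) → Fin 2 → ℝ
  | 0, _ => 1
  | n + 1, ψ => P.mulVec (ψ 0 * chainMean P n fun k => ψ (k + 1))

lemma chainMean_succ_apply (P : Matrix (Fin 2) (Fin 2) ℝ) (n : ℕ) (ψ : ℕ → Fin 2 → ℝ)
    (i : Fin 2) : chainMean P (n + 1) ψ i =
      ∑ j, P i j * (ψ 0 j * chainMean P n (fun k => ψ (k + 1)) j) := rfl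

variable {p l m : ℝ} {φ : Fin 2 → ℝ}

lemma chainMean_congr {P : Matrix (Fin 2) (Fin 2) ℝ} {n : ℕ} {ψ ψ' : ℕ → Fin 2 → ℝ}
    (h : ∀ k < n, ψ k = ψ' k) (i : Fin 2) : chainMean P n ψ i = chainMean P n ψ' i := by
  induction n generalizing ψ ψ' i with
  | zero => rfl
  | succ n ih =>
    rw [chainMean_succ_apply, chainMean_succ_apply, h 0 n.succ_pos]
    exact Finset.sum_congr rfl fun j _ => by
      rw [ih (fun k hk => h (k + 1) (Nat.succ_lt_succ hk)) j]

lemma energy_chainMean_le (hp0 : 0 ≤ p) (hp1 : p ≤ 1) (hl0 : 0 < l) (hl1 : l ≤ 1)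
    (hφ : ∀ i, 0 < φ i)
    (hm : IsPerronRoot (p * (1 - l)) ((1 - p) * (1 - l)) φ m) (n : ℕ) {ψ : ℕ → Fin 2 → ℝ}
    {b : ℕ → ℝ} (h : ∀ k, ψ k = φ ∧ b k = m ∨ ψ k = 1 ∧ b k = 1) :
    energy p l (chainMean (transitionMatrix (p * (1 - l)) ((1 - p) * (1 - l))) n ψ) ≤
      l * (∏ k ∈ Finset.range n, b k) ^ 2 := by
  induction n generalizing ψ b with
  | zero => simp [chainMean, energy]
  | succ n ih =>
    have ih' := ih (ψ := fun k => ψ (k + 1)) (b := fun k => b (k + 1)) fun k => h (k + 1)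
    rw [Finset.prod_range_succ', chainMean]
    rcases h 0 with ⟨h0, hb⟩ | ⟨h0, hb⟩ <;> rw [h0, hb]
    · refine (energy_mulVec_diagonal_le hp0 hp1 hl0 hφ hm _).trans ?_
      nlinarith [mul_le_mul_of_nonneg_left ih' (sq_nonneg m)]
    · rw [one_mul, mul_one]
      exact (energy_mulVec_le hp0 hp1 hl0 hl1 _).trans ih'

/-- The variance part of the energy is dropped; the factor `l` left before the squared mean cancels
the energy `l` of the constant function `1`. -/
lemma stationary_chainMean_le (hp0 : 0 ≤ p) (hp1 : p ≤ 1) (hl0 : 0 < l) (hl1 : l ≤ 1)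
    (hφ : ∀ i, 0 < φ i)
    (hm : IsPerronRoot (p * (1 - l)) ((1 - p) * (1 - l)) φ m) (n : ℕ) {ψ : ℕ → Fin 2 → ℝ}
    {b : ℕ → ℝ} (h : ∀ k, ψ k = φ ∧ b k = m ∨ ψ k = 1 ∧ b k = 1) :
    (1 - p) * chainMean (transitionMatrix (p * (1 - l)) ((1 - p) * (1 - l))) n ψ 0 +
      p * chainMean (transitionMatrix (p * (1 - l)) ((1 - p) * (1 - l))) n ψ 1 ≤
      ∏ k ∈ Finset.range n, b k := by
  have h1 := energy_chainMean_le hp0 hp1 hl0 hl1 hφ hm n h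
  have hb : 0 ≤ ∏ k ∈ Finset.range n, b k := Finset.prod_nonneg fun k _ => by
    rcases h k with ⟨-, hb⟩ | ⟨-, hb⟩ <;> rw [hb]
    exacts [hm.pos.le, zero_le_one]
  refine le_of_sq_le_sq ?_ hb
  refine le_of_mul_le_mul_left (le_trans ?_ h1) hl0
  rw [energy]
  have := mul_nonneg (mul_nonneg hp0 (sub_nonneg.2 hp1)) (sq_nonneg
    (chainMean (transitionMatrix (p * (1 - l)) ((1 - p) * (1 - l))) n ψ 1 -
      chainMean (transitionMatrix (p * (1 - l)) ((1 - p) * (1 - l))) n ψ 0))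
  linarith

/-- Perron-type lower bound: the iterates of a nonnegative matrix grow at least like the powers of
any of its eigenvalues. -/
lemma exists_le_chainMean {P : Matrix (Fin 2) (Fin 2) ℝ} (hP : ∀ i j, 0 ≤ P i j)
    (hφ : ∀ i, 0 ≤ φ i) (hm : 0 ≤ m)
    (h : Module.End.HasEigenvalue (Matrix.toLin' (P * Matrix.diagonal φ)) m) :
    ∃ v : Fin 2 → ℝ, (∀ i, 0 ≤ v i) ∧ (∃ i, 0 < v i) ∧
      ∀ n i, m ^ n * v i ≤ chainMean P n (fun _ => φ) i := by
  obtain ⟨u, hu⟩ := h.exists_hasEigenvector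
  have hu0 : 0 < ‖u‖ := norm_pos_iff.2 hu.2
  have hLu : P.mulVec (φ * u) = m • u := by
    have := hu.apply_eq_smul
    rw [Matrix.toLin'_apply, ← Matrix.mulVec_mulVec] at this
    rw [← this]
    congr 1
    ext i
    simp [Matrix.mulVec_diagonal]
  obtain ⟨i, hi⟩ : ∃ i, u i ≠ 0 := by
    by_contra! h0
    exact hu.2 (funext h0)
  -- Absolute values turn the eigenvector equation into an inequality, and the sup norm makes `v ≤
  -- 1`, which is the case `n = 0`.
  refine ⟨fun i => |u i| / ‖u‖, fun i => by positivity, ⟨i, by positivity⟩, fun n => ?_⟩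
  induction n with
  | zero =>
    intro i
    simpa [chainMean] using (div_le_one hu0).2 (norm_le_pi_norm u i)
  | succ n ih =>
    intro i
    have h1 : m * |u i| ≤ ∑ j, P i j * (φ j * |u j|) := by
      have := congrFun hLu i
      rw [← abs_of_nonneg hm, ← abs_mul]
      simp only [Pi.smul_apply, smul_eq_mul] at this
      rw [← this]
      change |∑ j, P i j * (φ * u) j| ≤ _
      refine (Finset.abs_sum_le_sum_abs _ _).trans_eq (Finset.sum_congr rfl fun j _ => ?_)
      rw [abs_mul, Pi.mul_apply, abs_mul, abs_of_nonneg (hP i j), abs_of_nonneg (hφ j)]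
    calc m ^ (n + 1) * (|u i| / ‖u‖) = m ^ n / ‖u‖ * (m * |u i|) := by ring
      _ ≤ m ^ n / ‖u‖ * ∑ j, P i j * (φ j * |u j|) := by gcongr
      _ = ∑ j, P i j * (φ j * (m ^ n * (|u j| / ‖u‖))) := by
          rw [Finset.mul_sum]; exact Finset.sum_congr rfl fun j _ => by ring
      _ ≤ _ := by
        rw [chainMean_succ_apply]
        exact Finset.sum_le_sum fun j _ =>
          mul_le_mul_of_nonneg_left (mul_le_mul_of_nonneg_left (ih j) (hφ j)) (hP i j)

end ChainMean

/-! ### Finite paths and their weights -/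

section Words

/-- The infinite sequence that continues a finite word by zeros. -/
def word {n : ℕ} (x : Fin n → Fin 2) : ℕ → Fin 2 :=
  fun k => if h : k < n then x ⟨k, h⟩ else 0

/-- The sequence with first term `j` and tail `x`. -/
def consSeq (j : Fin 2) (x : ℕ → Fin 2) : ℕ → Fin 2
  | 0 => j
  | k + 1 => x k

lemma word_cons {n : ℕ} (j : Fin 2) (x : Fin n → Fin 2) :
    word (Fin.cons j x : Fin (n + 1) → Fin 2) = consSeq j (word x) := by
  funext k
  cases k with
  | zero => rfl
  | succ k =>
    by_cases h : k < n
    · rw [word, dif_pos (Nat.succ_lt_succ h)]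
      change (Fin.cons j x : Fin (n + 1) → Fin 2) (Fin.succ ⟨k, h⟩) = word x k
      rw [Fin.cons_succ, word, dif_pos h]
    · rw [word, dif_neg (by omega), consSeq, word, dif_neg h]

lemma sum_word_succ (n : ℕ) (H : (ℕ → Fin 2) → ℝ) :
    ∑ x : Fin (n + 1) → Fin 2, H (word x) =
      ∑ j, ∑ y : Fin n → Fin 2, H (consSeq j (word y)) := by
  rw [← (Fin.consEquiv fun _ => Fin 2).sum_comp, Fintype.sum_prod_type]
  refine Finset.sum_congr rfl fun j _ => Finset.sum_congr rfl fun y _ => ?_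
  rw [← word_cons]
  rfl

/-- The first `t` terms are those of `x`, followed by the sequence `y`. -/
def appendSeq (t : ℕ) (x y : ℕ → Fin 2) : ℕ → Fin 2 :=
  fun k => if k < t then x k else y (k - t)

lemma appendSeq_succ_consSeq (t : ℕ) (j : Fin 2) (x y : ℕ → Fin 2) :
    appendSeq (t + 1) (consSeq j x) y = consSeq j (appendSeq t x y) := by
  funext k
  cases k with
  | zero => simp [appendSeq, consSeq]
  | succ k => simp [appendSeq, consSeq]

lemma sum_word_add (t u : ℕ) (H : (ℕ → Fin 2) → ℝ) :
    ∑ x : Fin (t + u) → Fin 2, H (word x) =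
      ∑ x : Fin t → Fin 2, ∑ y : Fin u → Fin 2, H (appendSeq t (word x) (word y)) := by
  induction t generalizing H with
  | zero =>
    have h : ∀ x y, appendSeq 0 x y = y := fun x y => by funext k; simp [appendSeq]
    have e : ∀ v, v = u → ∑ x : Fin v → Fin 2, H (word x) = ∑ y : Fin u → Fin 2, H (word y) := by
      rintro _ rfl; rfl
    rw [e _ (Nat.zero_add u)]
    simp [h]
  | succ t ih =>
    rw [Nat.add_right_comm, sum_word_succ,
      sum_word_succ t fun x => ∑ y : Fin u → Fin 2, H (appendSeq (t + 1) x (word y))]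
    refine Finset.sum_congr rfl fun j _ => ?_
    rw [ih fun x => H (consSeq j x)]
    simp only [appendSeq_succ_consSeq]

/-- The probability that the states of the chain with transition matrix `P` that follow the state
`i` are `x 0, …, x (n - 1)`. -/
def pathWeight (P : Matrix (Fin 2) (Fin 2) ℝ) : ℕ → Fin 2 → (ℕ → Fin 2) → ℝ
  | 0, _, _ => 1
  | n + 1, i, x => P i (x 0) * pathWeight P n (x 0) fun k => x (k + 1)

lemma pathWeight_eq_prod (P : Matrix (Fin 2) (Fin 2) ℝ) (n : ℕ) (i : Fin 2) (x : ℕ → Fin 2) :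
    pathWeight P (n + 1) i x = P i (x 0) * ∏ k ∈ Finset.range n, P (x k) (x (k + 1)) := by
  induction n generalizing i x with
  | zero => simp [pathWeight]
  | succ n ih =>
    rw [pathWeight, ih, Finset.prod_range_succ', mul_comm (P (x 0) (x (0 + 1)))]

lemma chainMean_eq_sum (P : Matrix (Fin 2) (Fin 2) ℝ) (n : ℕ) (ψ : ℕ → Fin 2 → ℝ) (i : Fin 2) :
    chainMean P n ψ i = ∑ x : Fin n → Fin 2, pathWeight P n i (word x) *
      ∏ k ∈ Finset.range n, ψ k (word x k) := by
  induction n generalizing ψ i with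
  | zero => simp [chainMean, pathWeight]
  | succ n ih =>
    rw [chainMean_succ_apply, sum_word_succ n fun x => pathWeight P (n + 1) i x *
      ∏ k ∈ Finset.range (n + 1), ψ k (x k)]
    refine Finset.sum_congr rfl fun j _ => ?_
    rw [ih, Finset.mul_sum, Finset.mul_sum]
    refine Finset.sum_congr rfl fun y _ => ?_
    rw [Finset.prod_range_succ']
    simp only [pathWeight, consSeq]
    ring

end Words

variable {Ω : Type*} [MeasurableSpace Ω] {μ : Measure Ω} {X : ℕ → Ω → Fin 2}
  {c0 c1 : ℕ → Ω → ℝ≥0} {p01 p10 p : ℝ}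

/-! ### Stationarity of the chain -/

section Chain

lemma IsStationaryTwoStateChain.sum_mul_transition
    (h : IsStationaryTwoStateChain μ X p01 p10 p) (j : Fin 2) :
    ∑ i, ![1 - p, p] i * transitionMatrix p01 p10 i j = ![1 - p, p] j :=
  congrFun h.invariant j

/-- A fictitious stationary state is placed before time `0`; invariance removes it again. This
matches the convention that `pathWeight` starts with a transition, and it includes `n = 0`. -/
lemma IsStationaryTwoStateChain.measureReal_eq [IsProbabilityMeasure μ]
    (h : IsStationaryTwoStateChain μ X p01 p10 p) (n : ℕ) (x : ℕ → Fin 2) :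
    μ.real {ω | ∀ k < n, X k ω = x k} =
      ∑ i, ![1 - p, p] i * pathWeight (transitionMatrix p01 p10) n i x := by
  cases n with
  | zero => simp [pathWeight]
  | succ n =>
    have := h.law n x
    simp only [← Nat.lt_succ_iff] at this
    rw [this]
    simp only [pathWeight_eq_prod, ← mul_assoc]
    rw [← Finset.sum_mul, h.sum_mul_transition]

lemma IsStationaryTwoStateChain.shift [IsProbabilityMeasure μ]
    (h : IsStationaryTwoStateChain μ X p01 p10 p) :
    IsStationaryTwoStateChain μ (fun k => X (k + 1)) p01 p10 p where
  measurable k := h.measurable (k + 1)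
  invariant := h.invariant
  law n x := by
    have hm : MeasurableSet {ω | ∀ k ≤ n, X (k + 1) ω = x k} := by
      simp only [Set.ofPred_forall]
      exact MeasurableSet.iInter fun k => MeasurableSet.iInter fun _ =>
        h.measurable (k + 1) (measurableSet_singleton (x k))
    have h1 := sum_measureReal_preimage_singleton
      (μ := μ.restrict {ω | ∀ k ≤ n, X (k + 1) ω = x k}) Finset.univ (f := X 0)
      fun j _ => h.measurable 0 (measurableSet_singleton j)
    rw [Finset.coe_univ, Set.preimage_univ, measureReal_restrict_apply MeasurableSet.univ,
      Set.univ_inter] at h1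
    rw [← h1]
    have h2 : ∀ j, (μ.restrict {ω | ∀ k ≤ n, X (k + 1) ω = x k}).real (X 0 ⁻¹' {j}) =
        ![1 - p, p] j * transitionMatrix p01 p10 j (x 0) *
          ∏ k ∈ Finset.range n, transitionMatrix p01 p10 (x k) (x (k + 1)) := fun j => by
      rw [measureReal_restrict_apply (h.measurable 0 (measurableSet_singleton j))]
      have h3 := h.law (n + 1) (consSeq j x)
      rw [Finset.prod_range_succ'] at h3
      simp only [consSeq] at h3
      rw [mul_assoc, mul_comm (transitionMatrix p01 p10 j (x 0)), ← h3]
      congr 1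
      ext ω
      simp only [Set.mem_inter_iff, Set.mem_preimage, Set.mem_singleton_iff, Set.mem_ofPred_eq]
      constructor
      · rintro ⟨h0, hk⟩ (_ | k) hkn
        · exact h0
        · exact hk k (by omega)
      · intro hk
        exact ⟨hk 0 (by omega), fun k hkn => hk (k + 1) (by omega)⟩
    rw [Finset.sum_congr rfl fun j _ => h2 j, ← Finset.sum_mul, h.sum_mul_transition]

end Chain

/-! ### Conditioning on the path of the chain -/

section Modulated

lemma IsIIDSequence.shift {c : ℕ → Ω → ℝ≥0} (h : IsIIDSequence μ c) :
    IsIIDSequence μ fun k => c (k + 1) where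
  measurable k := h.measurable (k + 1)
  indep := h.indep.precomp (add_left_injective 1)
  identDistrib k := (h.identDistrib (k + 1)).trans (h.identDistrib 1).symm

lemma IsMarkovModulated.shift [IsProbabilityMeasure μ]
    (h : IsMarkovModulated μ X c0 c1 p01 p10 p) :
    IsMarkovModulated μ (fun k => X (k + 1)) (fun k => c0 (k + 1)) (fun k => c1 (k + 1))
      p01 p10 p where
  chain := h.chain.shift
  iid0 := h.iid0.shift
  iid1 := h.iid1.shift
  indep_seq := by
    have hm : Measurable fun (a : ℕ → ℝ≥0) k => a (k + 1) := by fun_prop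
    exact h.indep_seq.comp hm hm
  indep_chain := by
    have hm : Measurable fun (a : ℕ → Fin 2) k => a (k + 1) := by fun_prop
    have hm' : Measurable fun (a : (ℕ → ℝ≥0) × (ℕ → ℝ≥0)) =>
        ((fun k => a.1 (k + 1), fun k => a.2 (k + 1)) : (ℕ → ℝ≥0) × (ℕ → ℝ≥0)) := by fun_prop
    exact h.indep_chain.comp hm hm'

lemma IsMarkovModulated.shift_add [IsProbabilityMeasure μ]
    (h : IsMarkovModulated μ X c0 c1 p01 p10 p) (s : ℕ) :
    IsMarkovModulated μ (fun k => X (s + k)) (fun k => c0 (s + k)) (fun k => c1 (s + k))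
      p01 p10 p := by
  induction s with
  | zero => simpa using h
  | succ s ih => simpa only [Nat.add_right_comm, ← Nat.add_assoc] using ih.shift

lemma measurable_modulatedRate_path (h : IsMarkovModulated μ X c0 c1 p01 p10 p)
    (x : ℕ → Fin 2) (k : ℕ) :
    Measurable fun ω => modulatedRate (fun k _ => x k) c0 c1 ω k := by
  simp only [modulatedRate]
  split_ifs
  exacts [h.iid1.measurable k, h.iid0.measurable k]

/-- A fixed path selects disjoint sets of slots from the two sequences, so the probability factors
first between the sequences and then within each. -/
lemma iIndepFun_modulatedRate_path (h : IsMarkovModulated μ X c0 c1 p01 p10 p)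
    (x : ℕ → Fin 2) :
    iIndepFun (fun k ω => modulatedRate (fun k _ => x k) c0 c1 ω k) μ := by
  rw [iIndepFun_iff_measure_inter_preimage_eq_mul]
  intro S B hB
  have hI : (⋂ k ∈ S, (fun ω => modulatedRate (fun k _ => x k) c0 c1 ω k) ⁻¹' B k) =
      (fun ω k => c0 k ω) ⁻¹' {a | ∀ k ∈ S.filter fun k => ¬ x k = 1, a k ∈ B k} ∩
        (fun ω k => c1 k ω) ⁻¹' {a | ∀ k ∈ S.filter fun k => x k = 1, a k ∈ B k} := by
    ext ω
    simp only [modulatedRate, Set.mem_iInter, Set.mem_preimage, Finset.mem_filter,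
      Set.mem_inter_iff, Set.mem_ofPred_eq, and_imp]
    constructor
    · intro hk
      exact ⟨fun k hkS hx => by simpa [hx] using hk k hkS,
        fun k hkS hx => by simpa [hx] using hk k hkS⟩
    · rintro ⟨h0, h1⟩ k hkS
      split_ifs with hx
      exacts [h1 k hkS hx, h0 k hkS hx]
  have hm : ∀ S' ⊆ S, MeasurableSet {a : ℕ → ℝ≥0 | ∀ k ∈ S', a k ∈ B k} := fun S' hS' => by
    simp only [Set.ofPred_forall]
    exact MeasurableSet.iInter fun k => MeasurableSet.iInter fun hk =>
      measurable_pi_apply k (hB k (hS' hk))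
  have hpre : ∀ (c : ℕ → Ω → ℝ≥0) (S' : Finset ℕ),
      (fun ω k => c k ω) ⁻¹' {a | ∀ k ∈ S', a k ∈ B k} = ⋂ k ∈ S', c k ⁻¹' B k := fun c S' => by
    ext ω; simp
  rw [hI, h.indep_seq.measure_inter_preimage_eq_mul _ _ (hm _ (Finset.filter_subset _ _))
    (hm _ (Finset.filter_subset _ _)), hpre, hpre,
    h.iid0.indep.measure_inter_preimage_eq_mul _ fun k hk => hB k (Finset.mem_filter.1 hk).1,
    h.iid1.indep.measure_inter_preimage_eq_mul _ fun k hk => hB k (Finset.mem_filter.1 hk).1,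
    mul_comm, ← Finset.prod_filter_mul_prod_filter_not S fun k => x k = 1]
  congr 1
  · exact Finset.prod_congr rfl fun k hk => by simp [modulatedRate, (Finset.mem_filter.1 hk).2]
  · exact Finset.prod_congr rfl fun k hk => by simp [modulatedRate, (Finset.mem_filter.1 hk).2]

lemma identDistrib_modulatedRate_path (h : IsMarkovModulated μ X c0 c1 p01 p10 p)
    (x : ℕ → Fin 2) (t : ℕ) :
    IdentDistrib (fun ω k => modulatedRate (fun k _ => x k) c0 c1 ω (t + k))
      (fun ω k => modulatedRate (fun k _ => x (t + k)) c0 c1 ω k) μ μ := by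
  refine IdentDistrib.pi (fun k => ?_)
    ((iIndepFun_modulatedRate_path h x).precomp (add_right_injective t))
    (iIndepFun_modulatedRate_path h fun k => x (t + k))
  simp only [modulatedRate]
  split_ifs
  · exact (h.iid1.identDistrib (t + k)).trans (h.iid1.identDistrib k).symm
  · exact (h.iid0.identDistrib (t + k)).trans (h.iid0.identDistrib k).symm

lemma measurable_modulatedRate (h : IsMarkovModulated μ X c0 c1 p01 p10 p) :
    Measurable (modulatedRate X c0 c1) := by
  refine measurable_pi_iff.2 fun k => ?_
  exact Measurable.ite (h.chain.measurable k (measurableSet_singleton 1)) (h.iid1.measurable k)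
    (h.iid0.measurable k)

/-- Conditioning on the path of the chain. -/
lemma integral_modulatedRate [IsProbabilityMeasure μ]
    (h : IsMarkovModulated μ X c0 c1 p01 p10 p) (n : ℕ) {g : (ℕ → ℝ≥0) → ℝ}
    (hg : Measurable g) {C : ℝ} (hC : ∀ c, ‖g c‖ ≤ C)
    (hdep : ∀ c c', (∀ k < n, c k = c' k) → g c = g c') :
    ∫ ω, g (modulatedRate X c0 c1 ω) ∂μ =
      ∑ i, ![1 - p, p] i * ∑ x : Fin n → Fin 2,
        pathWeight (transitionMatrix p01 p10) n i (word x) *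
          ∫ ω, g (modulatedRate (fun k _ => word x k) c0 c1 ω) ∂μ := by
  have hset : ∀ x : Fin n → Fin 2, MeasurableSet {y : ℕ → Fin 2 | ∀ k < n, y k = word x k} :=
    fun x => by
      simp only [Set.ofPred_forall]
      exact MeasurableSet.iInter fun k => MeasurableSet.iInter fun _ =>
        measurable_pi_apply k (measurableSet_singleton _)
  have hX : Measurable fun ω k => X k ω := measurable_pi_iff.2 h.chain.measurable
  have hsel : ∀ x : Fin n → Fin 2, Measurable fun a : (ℕ → ℝ≥0) × (ℕ → ℝ≥0) =>
      g fun k => if word x k = 1 then a.2 k else a.1 k := fun x => by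
    refine hg.comp (measurable_pi_iff.2 fun k => ?_)
    split_ifs <;> fun_prop
  have hc : Measurable fun ω => ((fun k => c0 k ω, fun k => c1 k ω) : (ℕ → ℝ≥0) × (ℕ → ℝ≥0)) :=
    (measurable_pi_iff.2 h.iid0.measurable).prodMk (measurable_pi_iff.2 h.iid1.measurable)
  -- Exactly one word agrees with the actual path on the first `n` slots, and `g` sees no others, so
  -- the zeros that continue the word do not matter.
  have hpt : ∀ ω, g (modulatedRate X c0 c1 ω) = ∑ x : Fin n → Fin 2,
      Set.indicator {y : ℕ → Fin 2 | ∀ k < n, y k = word x k} (fun _ => (1 : ℝ)) (fun k => X k ω) *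
        g (modulatedRate (fun k _ => word x k) c0 c1 ω) := fun ω => by
    rw [Finset.sum_eq_single fun k : Fin n => X k ω]
    · rw [Set.indicator_of_mem, one_mul]
      · exact hdep _ _ fun k hk => by simp [modulatedRate, word, hk]
      · intro k hk
        simp [word, hk]
    · intro x _ hx
      rw [Set.indicator_of_notMem, zero_mul]
      intro hmem
      refine hx (funext fun k => ?_)
      simpa [word] using (hmem k k.2).symm
    · simp
  simp only [hpt]
  rw [integral_finsetSum]
  · simp only [Finset.mul_sum, ← mul_assoc]
    rw [Finset.sum_comm]
    refine Finset.sum_congr rfl fun x _ => ?_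
    rw [← Finset.sum_mul, ← h.chain.measureReal_eq]
    refine (h.indep_chain.integral_fun_comp_mul_comp (f := Set.indicator _ fun _ => (1 : ℝ))
      (g := fun a => g fun k => if word x k = 1 then a.2 k else a.1 k)
      hX.aemeasurable hc.aemeasurable
      (measurable_const.indicator (hset x)).aestronglyMeasurable
      (hsel x).aestronglyMeasurable).trans ?_
    congr 1
    exact integral_indicator_one (hX (hset x))
  · intro x _
    refine Integrable.of_bound (C := 1 * C) ?_ (ae_of_all _ fun ω => ?_)
    · exact (((measurable_const.indicator (hset x)).comp hX).mul
        ((hsel x).comp hc)).aestronglyMeasurable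
    · rw [norm_mul]
      refine mul_le_mul ?_ (hC _) (norm_nonneg _) zero_le_one
      refine (norm_indicator_le_norm_self _ _).trans ?_
      simp

end Modulated

/-! ### The linear recursion for the bound -/

section WindowBound

/-- The bound for the moment-generating function of `windowCost` when every served slot
contributes a factor `m` and every window a factor `v`. -/
noncomputable def windowBound (d : ℕ) (m v : ℝ) : ℕ → ℝ
  | 0 => 1
  | r + 1 => m * windowBound d m v r + v * windowBound d m v (r - (d - 1))
termination_by r => r

variable {d : ℕ} {m v : ℝ}

@[simp] lemma windowBound_zero : windowBound d m v 0 = 1 := by rw [windowBound]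

lemma windowBound_succ (r : ℕ) : windowBound d m v (r + 1) =
    m * windowBound d m v r + v * windowBound d m v (r - (d - 1)) := by
  rw [windowBound]

lemma windowBound_nonneg (hm : 0 ≤ m) (hv : 0 ≤ v) (r : ℕ) : 0 ≤ windowBound d m v r := by
  induction r using Nat.strong_induction_on with
  | _ r ih =>
    cases r with
    | zero => simp
    | succ r =>
      rw [windowBound_succ]
      exact add_nonneg (mul_nonneg hm (ih _ (by omega))) (mul_nonneg hv (ih _ (by omega)))

lemma pow_mul_windowBound_le (hm : 0 ≤ m) (hv : 0 ≤ v) (r i : ℕ) :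
    m ^ i * windowBound d m v r ≤ windowBound d m v (r + i) := by
  induction i with
  | zero => simp
  | succ i ih =>
    rw [← add_assoc, windowBound_succ, pow_succ', mul_assoc]
    have := mul_nonneg hv (windowBound_nonneg (d := d) hm hv (r + i - (d - 1)))
    have := mul_le_mul_of_nonneg_left ih hm
    linarith

/-- The weight `m ^ (d - i)` absorbs the factor `m` of each step, so a step adds only its window
term. That term sits at an index at most `r` and is compared with index `r` by
`pow_mul_windowBound_le`. At `i = d` the weight is `1`. -/
lemma windowBound_add_le (hm : 0 ≤ m) (hm1 : m ≤ 1) (hv : 0 ≤ v) (r i : ℕ) (hi : i ≤ d) :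
    m ^ (d - i) * windowBound d m v (r + i) ≤ (m ^ d + i * v) * windowBound d m v r := by
  induction i with
  | zero => simp
  | succ i ih =>
    -- The gap up to `r` is `d - (i + 1)`, or less if the subtraction truncates at `0`; then `m ≤ 1`
    -- is needed.
    have h1 : m ^ (d - (i + 1)) * windowBound d m v (r + i - (d - 1)) ≤ windowBound d m v r := by
      have h2 := pow_mul_windowBound_le (d := d) hm hv (r + i - (d - 1))
        (r - (r + i - (d - 1)))
      rw [Nat.add_sub_cancel' (by omega : r + i - (d - 1) ≤ r)] at h2
      refine le_trans (mul_le_mul_of_nonneg_right ?_ (windowBound_nonneg hm hv _)) h2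
      exact pow_le_pow_of_le_one hm hm1 (by omega)
    have h3 : m ^ (d - i) = m ^ (d - (i + 1)) * m := by rw [← pow_succ]; congr 1; omega
    have ih' := ih (by omega)
    rw [h3] at ih'
    rw [← add_assoc, windowBound_succ]
    push_cast
    linarith [mul_le_mul_of_nonneg_left h1 hv]

lemma windowBound_mul_le (hm : 0 ≤ m) (hm1 : m ≤ 1) (hv : 0 ≤ v) (n : ℕ) :
    windowBound d m v (n * d) ≤ (m ^ d + d * v) ^ n := by
  induction n with
  | zero => simp
  | succ n ih =>
    have h := windowBound_add_le (d := d) hm hm1 hv (n * d) d le_rfl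
    rw [Nat.sub_self, pow_zero, one_mul] at h
    rw [Nat.succ_mul, pow_succ']
    refine h.trans (mul_le_mul_of_nonneg_left ih ?_)
    positivity

end WindowBound

variable {Ω : Type*} [MeasurableSpace Ω] {μ : Measure Ω}
  {X : ℕ → Ω → Fin 2} {c0 c1 : ℕ → Ω → ℝ≥0} {p01 p10 p θ m : ℝ}

lemma exp_neg_mul_le_one (hθ : 0 < θ) (a : ℝ≥0) : Real.exp (-θ * a) ≤ 1 :=
  Real.exp_le_one_iff.2 (by have := a.2; simp only [neg_mul, Left.neg_nonpos_iff]; positivity)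

lemma integrable_exp_neg [IsProbabilityMeasure μ] (hθ : 0 < θ) {Y : Ω → ℝ≥0} (hY : Measurable Y) :
    Integrable (fun ω => Real.exp (-θ * Y ω)) μ := by
  refine Integrable.of_bound (C := 1) ?_ (ae_of_all _ fun ω => ?_)
  · exact (Real.measurable_exp.comp
      (measurable_const.mul hY.coe_nnreal_real)).aestronglyMeasurable
  · rw [Real.norm_eq_abs, abs_of_pos (Real.exp_pos _)]
    exact exp_neg_mul_le_one hθ _

lemma integral_exp_neg_pos [IsProbabilityMeasure μ] (hθ : 0 < θ) {Y : Ω → ℝ≥0} (hY : Measurable Y) :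
    0 < ∫ ω, Real.exp (-θ * Y ω) ∂μ :=
  integral_exp_pos (integrable_exp_neg hθ hY)

lemma integral_exp_neg_le_one [IsProbabilityMeasure μ] (hθ : 0 < θ) (Y : Ω → ℝ≥0) :
    ∫ ω, Real.exp (-θ * Y ω) ∂μ ≤ 1 := by
  refine (integral_mono_of_nonneg (ae_of_all _ fun ω => (Real.exp_pos _).le)
    (integrable_const (1 : ℝ)) (ae_of_all _ fun ω => exp_neg_mul_le_one hθ _)).trans ?_
  simp

/-- The moment-generating functions of the service rates in the two states. -/
noncomputable def rateMGF (μ : Measure Ω) (c0 c1 : ℕ → Ω → ℝ≥0) (θ : ℝ) : Fin 2 → ℝ :=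
  ![mgf (fun ω => (c0 0 ω : ℝ)) μ θ, mgf (fun ω => (c1 0 ω : ℝ)) μ θ]

/-! ### Moment-generating function bounds -/

section Rate

lemma rateMGF_pos [IsProbabilityMeasure μ]
    (h : IsMarkovModulated μ X c0 c1 p01 p10 p) (hθ : 0 < θ) (i : Fin 2) :
    0 < rateMGF μ c0 c1 (-θ) i := by
  fin_cases i
  exacts [integral_exp_neg_pos hθ (h.iid0.measurable 0),
    integral_exp_neg_pos hθ (h.iid1.measurable 0)]

lemma rateMGF_le_one [IsProbabilityMeasure μ] (hθ : 0 < θ) (i : Fin 2) :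
    rateMGF μ c0 c1 (-θ) i ≤ 1 := by
  fin_cases i
  exacts [integral_exp_neg_le_one hθ _, integral_exp_neg_le_one hθ _]

lemma mgf_modulatedRate_path
    (h : IsMarkovModulated μ X c0 c1 p01 p10 p) (x : ℕ → Fin 2) (k : ℕ) :
    ∫ ω, Real.exp (θ * modulatedRate (fun k _ => x k) c0 c1 ω k) ∂μ =
      rateMGF μ c0 c1 θ (x k) := by
  have hm : Measurable fun a : ℝ≥0 => Real.exp (θ * a) := by fun_prop
  simp only [modulatedRate]
  rcases Fin.exists_fin_two.1 ⟨x k, rfl⟩ with hx | hx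
  · simp only [hx, Fin.reduceEq, if_false]
    exact ((h.iid0.identDistrib k).comp hm).integral_eq
  · simp only [hx, if_true]
    exact ((h.iid1.identDistrib k).comp hm).integral_eq

lemma rateMGF_shift
    (h : IsMarkovModulated μ X c0 c1 p01 p10 p) (s : ℕ) :
    rateMGF μ (fun k => c0 (s + k)) (fun k => c1 (s + k)) θ = rateMGF μ c0 c1 θ := by
  have hm : Measurable fun a : ℝ≥0 => Real.exp (θ * a) := by fun_prop
  funext i
  fin_cases i
  exacts [((h.iid0.identDistrib s).comp hm).integral_eq,
    ((h.iid1.identDistrib s).comp hm).integral_eq]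

lemma integral_prod_path
    (h : IsMarkovModulated μ X c0 c1 p01 p10 p) (A : Finset ℕ) (n : ℕ) (x : ℕ → Fin 2) :
    ∫ ω, ∏ k ∈ Finset.range n, (if k ∈ A then
      Real.exp (θ * modulatedRate (fun k _ => x k) c0 c1 ω k) else 1) ∂μ =
      ∏ k ∈ Finset.range n, (if k ∈ A then rateMGF μ c0 c1 θ else 1) (x k) := by
  have : IsProbabilityMeasure μ := h.iid0.indep.isProbabilityMeasure
  simp only [Finset.prod_range]
  have hm : ∀ k : Fin n, Measurable fun a : ℝ≥0 => if (k : ℕ) ∈ A then Real.exp (θ * a) else 1 :=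
    fun k => by split_ifs <;> fun_prop
  refine (((iIndepFun_modulatedRate_path h x).precomp
    (Fin.val_injective (n := n))).integral_fun_prod_comp
    (f := fun (k : Fin n) (a : ℝ≥0) => if (k : ℕ) ∈ A then Real.exp (θ * a) else 1)
    (fun k => (measurable_modulatedRate_path h x k).aemeasurable)
    fun k => (hm k).aestronglyMeasurable).trans ?_
  refine Finset.prod_congr rfl fun k _ => ?_
  split_ifs with hk
  · exact mgf_modulatedRate_path h x k
  · simp

lemma integral_prod_modulatedRate [IsProbabilityMeasure μ]
    (h : IsMarkovModulated μ X c0 c1 p01 p10 p) (hθ : 0 < θ) (A : Finset ℕ) (n : ℕ) :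
    ∫ ω, ∏ k ∈ Finset.range n, (if k ∈ A then
      Real.exp (-θ * modulatedRate X c0 c1 ω k) else 1) ∂μ =
      ∑ i, ![1 - p, p] i * chainMean (transitionMatrix p01 p10) n
        (fun k => if k ∈ A then rateMGF μ c0 c1 (-θ) else 1) i := by
  have hm : ∀ k, Measurable fun a : ℕ → ℝ≥0 => if k ∈ A then Real.exp (-θ * a k) else 1 :=
    fun k => by split_ifs <;> fun_prop
  rw [integral_modulatedRate h n (C := 1) (g := fun c => ∏ k ∈ Finset.range n, (if k ∈ A then
      Real.exp (-θ * c k) else 1))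
    (Finset.measurable_prod _ fun k _ => hm k)]
  · simp only [integral_prod_path h, chainMean_eq_sum]
  · intro c
    rw [norm_prod]
    refine Finset.prod_le_one (fun _ _ => norm_nonneg _) fun k _ => ?_
    split_ifs
    · rw [Real.norm_eq_abs, abs_of_pos (Real.exp_pos _)]
      exact exp_neg_mul_le_one hθ _
    · simp
  · intro c c' hc
    exact Finset.prod_congr rfl fun k hk => by rw [hc k (Finset.mem_range.1 hk)]

lemma IsMarkovModulated.prob_mem [IsProbabilityMeasure μ]
    (h : IsMarkovModulated μ X c0 c1 p01 p10 p) : 0 ≤ p ∧ p ≤ 1 := by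
  have h1 := h.chain.law 0 fun _ => 1
  have h0 := h.chain.law 0 fun _ => 0
  simp only [Matrix.cons_val_one, Matrix.cons_val_zero, Finset.range_zero, Finset.prod_empty,
    mul_one] at h0 h1
  exact ⟨h1 ▸ measureReal_nonneg, sub_nonneg.1 (h0 ▸ measureReal_nonneg)⟩

lemma IsMarkovModulated.balance
    (h : IsMarkovModulated μ X c0 c1 p01 p10 p) : p01 = p * (1 - (1 - p01 - p10)) ∧
    p10 = (1 - p) * (1 - (1 - p01 - p10)) := by
  have h1 := h.chain.sum_mul_transition 1
  simp [Fin.sum_univ_two, transitionMatrix] at h1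
  constructor <;> linarith

/-- The gaps in `A` are filled by factors `1`, which turn into bare applications of `P`; the energy
seminorm handles both kinds of step. -/
lemma integral_prod_le [IsProbabilityMeasure μ]
    (h : IsMarkovModulated μ X c0 c1 p01 p10 p) (hp01 : 0 ≤ p01) (hp10 : 0 ≤ p10)
    (hp : p01 + p10 < 1) (hθ : 0 < θ)
    (hm : IsPerronRoot p01 p10 (rateMGF μ c0 c1 (-θ)) m) (A : Finset ℕ) :
    ∫ ω, ∏ k ∈ A, Real.exp (-θ * modulatedRate X c0 c1 ω k) ∂μ ≤ m ^ A.card := by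
  obtain ⟨n, hn⟩ := A.exists_nat_subset_range
  have hprod : ∀ f : ℕ → ℝ, ∏ k ∈ A, f k = ∏ k ∈ Finset.range n, if k ∈ A then f k else 1 :=
    fun f => by rw [Finset.prod_ite_mem, Finset.inter_eq_right.2 hn]
  simp only [hprod]
  rw [integral_prod_modulatedRate h hθ, Fin.sum_univ_two, ← Finset.prod_const, hprod]
  obtain ⟨hp0, hp1⟩ := h.prob_mem
  have hφ := rateMGF_pos h hθ
  obtain ⟨e1, e2⟩ := h.balance
  generalize rateMGF μ c0 c1 (-θ) = φ at hm hφ ⊢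
  -- Stationarity expresses both transition probabilities through `p` and `l`, the parameters of the
  -- energy estimates.
  obtain ⟨l, hl⟩ : ∃ l, l = 1 - p01 - p10 := ⟨_, rfl⟩
  rw [← hl] at e1 e2
  have hl0 : 0 < l := by linarith
  have hl1 : l ≤ 1 := by linarith
  clear hl
  subst e1 e2
  refine stationary_chainMean_le hp0 hp1 hl0 hl1 hφ hm n fun k => ?_
  by_cases hk : k ∈ A <;> simp [hk]

lemma integrable_exp_windowCost_mul_prod [IsProbabilityMeasure μ]
    (h : IsMarkovModulated μ X c0 c1 p01 p10 p) (hθ : 0 < θ) (d : ℕ) (w : ℝ≥0)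
    (r : ℕ) (A : Finset ℕ) :
    Integrable (fun ω => Real.exp (-θ * windowCost d w (modulatedRate X c0 c1 ω) r) *
      ∏ k ∈ A, Real.exp (-θ * modulatedRate X c0 c1 ω k)) μ := by
  have hX := measurable_modulatedRate h
  refine Integrable.of_bound (C := 1) ?_ (ae_of_all _ fun ω => ?_)
  · have h1 : Measurable fun a : ℕ → ℝ≥0 => Real.exp (-θ * windowCost d w a r) := by
      have := measurable_windowCost d w r
      fun_prop
    have h2 : Measurable fun a : ℕ → ℝ≥0 => ∏ k ∈ A, Real.exp (-θ * a k) := by fun_prop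
    exact ((h1.mul h2).comp hX).aestronglyMeasurable
  · rw [Real.norm_eq_abs, abs_of_nonneg (mul_nonneg (Real.exp_pos _).le
      (Finset.prod_nonneg fun _ _ => (Real.exp_pos _).le))]
    exact mul_le_one₀ (exp_neg_mul_le_one hθ _)
      (Finset.prod_nonneg fun _ _ => (Real.exp_pos _).le)
      (Finset.prod_le_one (fun _ _ => (Real.exp_pos _).le) fun _ _ => exp_neg_mul_le_one hθ _)

/-- The set `A` makes the induction work without independence between slots: a served slot moves
from the recursion into `A`, a window leaves `A` alone, and the expectation over the chain is
estimated only at `r = 0`. -/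
lemma integral_exp_windowCost_mul_prod_le [IsProbabilityMeasure μ]
    (h : IsMarkovModulated μ X c0 c1 p01 p10 p) (hp01 : 0 ≤ p01) (hp10 : 0 ≤ p10)
    (hp : p01 + p10 < 1) (hθ : 0 < θ) (hm : IsPerronRoot p01 p10 (rateMGF μ c0 c1 (-θ)) m) (d : ℕ)
    (w : ℝ≥0) (r : ℕ)
    (A : Finset ℕ) (hA : ∀ k ∈ A, r ≤ k) :
    ∫ ω, Real.exp (-θ * windowCost d w (modulatedRate X c0 c1 ω) r) *
      ∏ k ∈ A, Real.exp (-θ * modulatedRate X c0 c1 ω k) ∂μ ≤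
      m ^ A.card * windowBound d m (Real.exp (-θ * w)) r := by
  induction r using Nat.strong_induction_on generalizing A with
  | _ r ih =>
    cases r with
    | zero => simpa using integral_prod_le h hp01 hp10 hp hθ hm A
    | succ r =>
      have hr : r ∉ A := fun hr => by have := hA r hr; omega
      have ih1 := ih r (by omega) (insert r A) fun k hk => by
        rcases Finset.mem_insert.1 hk with rfl | hk
        exacts [le_rfl, (Nat.le_succ r).trans (hA k hk)]
      have ih2 := ih (r - (d - 1)) (by omega) A fun k hk => by have := hA k hk; omega
      have hi1 := integrable_exp_windowCost_mul_prod h hθ d w r (insert r A)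
      have hi2 := (integrable_exp_windowCost_mul_prod h hθ d w (r - (d - 1)) A).const_mul
        (Real.exp (-θ * w))
      rw [Finset.card_insert_of_notMem hr] at ih1
      calc _ ≤ ∫ ω, Real.exp (-θ * windowCost d w (modulatedRate X c0 c1 ω) r) *
                ∏ k ∈ insert r A, Real.exp (-θ * modulatedRate X c0 c1 ω k) +
              Real.exp (-θ * w) *
                (Real.exp (-θ * windowCost d w (modulatedRate X c0 c1 ω) (r - (d - 1))) *
                ∏ k ∈ A, Real.exp (-θ * modulatedRate X c0 c1 ω k)) ∂μ := by
            refine integral_mono (integrable_exp_windowCost_mul_prod h hθ d w (r + 1) A)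
              (hi1.add hi2) fun ω => ?_
            beta_reduce
            rw [Finset.prod_insert hr, ← mul_assoc, ← mul_assoc, ← Real.exp_add, ← Real.exp_add,
              ← add_mul]
            refine mul_le_mul_of_nonneg_right ?_
              (Finset.prod_nonneg fun _ _ => (Real.exp_pos _).le)
            rw [windowCost_succ]
            rcases min_choice (windowCost d w (modulatedRate X c0 c1 ω) r +
              modulatedRate X c0 c1 ω r)
              (windowCost d w (modulatedRate X c0 c1 ω) (r - (d - 1)) + w) with e | e <;> rw [e]
            · refine le_trans (le_of_eq ?_) (le_add_of_nonneg_right (Real.exp_pos _).le)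
              push_cast
              ring_nf
            · refine le_trans (le_of_eq ?_) (le_add_of_nonneg_left (Real.exp_pos _).le)
              push_cast
              ring_nf
        _ = _ := integral_add hi1 hi2
        _ ≤ _ := by
            rw [integral_const_mul, windowBound_succ]
            have := mul_le_mul_of_nonneg_left ih2 (Real.exp_pos (-θ * w)).le
            rw [pow_succ] at ih1
            linarith

lemma bivariateMGF_feedbackService {d : ℕ} (hd : 0 < d) (w : ℝ≥0) {s t : ℕ} (hst : s ≤ t) :
    bivariateMGF μ (fun ω => feedbackService d w (modulatedService X c0 c1 ω)) θ s t =
      ∫ ω, Real.exp (θ * windowCost d w (modulatedRate (fun k => X (s + k))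
        (fun k => c0 (s + k)) (fun k => c1 (s + k)) ω) (t - s)) ∂μ := by
  simp only [bivariateMGF, mgf, modulatedService, feedbackService_eq_windowCost hd hst]
  rfl

lemma bivariateMGF_feedbackService_le [IsProbabilityMeasure μ]
    (h : IsMarkovModulated μ X c0 c1 p01 p10 p) (hp01 : 0 ≤ p01) (hp10 : 0 ≤ p10)
    (hp : p01 + p10 < 1) (hθ : 0 < θ) (hm : IsPerronRoot p01 p10 (rateMGF μ c0 c1 (-θ)) m) {d : ℕ}
    (hd : 0 < d)
    (w : ℝ≥0) {s t : ℕ} (hst : s ≤ t) :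
    bivariateMGF μ (fun ω => feedbackService d w (modulatedService X c0 c1 ω)) (-θ) s t ≤
      (m ^ d + d * Real.exp (-θ * w)) ^ ((t - s) / d) := by
  rw [bivariateMGF_feedbackService hd w hst]
  have hs := h.shift_add s
  rw [← rateMGF_shift h s] at hm
  -- The length is rounded down to a multiple of `d`, which can only decrease the cost and so
  -- increase the exponential.
  refine le_trans (integral_mono ?_ ?_ fun ω => ?_) ((integral_exp_windowCost_mul_prod_le hs
    hp01 hp10 hp hθ hm d w ((t - s) / d * d) ∅ (by simp)).trans ?_)
  · simpa using integrable_exp_windowCost_mul_prod hs hθ d w (t - s) ∅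
  · exact integrable_exp_windowCost_mul_prod hs hθ d w _ ∅
  · simp only [Finset.prod_empty, mul_one, neg_mul]
    refine Real.exp_le_exp.2 (neg_le_neg (mul_le_mul_of_nonneg_left ?_ hθ.le))
    exact_mod_cast windowCost_mono (Nat.div_mul_le_self _ _)
  · rw [Finset.card_empty, pow_zero, one_mul]
    exact windowBound_mul_le hm.pos.le hm.le_one (Real.exp_pos _).le _

end Rate

/-! ### Limits of logarithmic averages -/

section LogLimit

/-- Fekete's lemma for sequences that are supermultiplicative up to a constant. -/
lemma exists_tendsto_log_div {a : ℕ → ℝ} {ε : ℝ} (hε : 0 < ε) (hε1 : ε ≤ 1) (ha : ∀ t, 0 < a t)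
    (ha1 : ∀ t, a t ≤ 1) (h : ∀ t u, ε * (a t * a u) ≤ a (t + u)) :
    ∃ L, Tendsto (fun t : ℕ => Real.log (a t) / t) atTop (𝓝 L) := by
  -- Adding `-log ε` once to each term absorbs the constant into exact subadditivity.
  have hsub : Subadditive fun t => -Real.log ε - Real.log (a t) := fun t u => by
    have := Real.log_le_log (mul_pos hε (mul_pos (ha t) (ha u))) (h t u)
    rw [Real.log_mul hε.ne' (mul_pos (ha t) (ha u)).ne',
      Real.log_mul (ha t).ne' (ha u).ne'] at this
    linarith
  have hlim := hsub.tendsto_lim ⟨0, by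
    rintro _ ⟨t, rfl⟩
    have h1 := Real.log_nonpos (ha t).le (ha1 t)
    have h2 := Real.log_nonpos hε.le hε1
    exact div_nonneg (by linarith) t.cast_nonneg⟩
  refine ⟨-(0 + hsub.lim), (((tendsto_const_div_atTop_nhds_zero_nat (Real.log ε)).add
    hlim).neg).congr fun t => ?_⟩
  ring

/-- A sum of two positive terms lies between their maximum and twice it, so on this scale the larger
rate wins; a term of weight zero is simply absent. -/
lemma exists_tendsto_log_add_div {a b : ℕ → ℝ} {A B α β : ℝ} (hα : 0 ≤ α) (hβ : 0 ≤ β)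
    (hαβ : α + β = 1) (ha : ∀ t, 0 < a t) (hb : ∀ t, 0 < b t)
    (hA : Tendsto (fun t : ℕ => Real.log (a t) / t) atTop (𝓝 A))
    (hB : Tendsto (fun t : ℕ => Real.log (b t) / t) atTop (𝓝 B)) :
    ∃ L, Tendsto (fun t : ℕ => Real.log (α * a t + β * b t) / t) atTop (𝓝 L) := by
  rcases hα.eq_or_lt with rfl | hα
  · obtain rfl : β = 1 := by linarith
    exact ⟨B, by simpa using hB⟩
  rcases hβ.eq_or_lt with rfl | hβ
  · obtain rfl : α = 1 := by linarith
    exact ⟨A, by simpa using hA⟩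
  have hA' : Tendsto (fun t : ℕ => Real.log (α * a t) / t) atTop (𝓝 (0 + A)) :=
    ((tendsto_const_div_atTop_nhds_zero_nat (Real.log α)).add hA).congr fun t => by
      rw [Real.log_mul hα.ne' (ha t).ne', add_div]
  have hB' : Tendsto (fun t : ℕ => Real.log (β * b t) / t) atTop (𝓝 (0 + B)) :=
    ((tendsto_const_div_atTop_nhds_zero_nat (Real.log β)).add hB).congr fun t => by
      rw [Real.log_mul hβ.ne' (hb t).ne', add_div]
  have hM := hA'.max hB'
  have hM' := (tendsto_const_div_atTop_nhds_zero_nat (Real.log 2)).add hM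
  rw [zero_add (max _ _)] at hM'
  refine ⟨_, tendsto_of_tendsto_of_tendsto_of_le_of_le hM hM' (fun t => ?_) fun t => ?_⟩
  · have h1 := mul_pos hα (ha t)
    have h2 := mul_pos hβ (hb t)
    exact max_le
      (div_le_div_of_nonneg_right (Real.log_le_log h1 (by linarith)) t.cast_nonneg)
      (div_le_div_of_nonneg_right (Real.log_le_log h2 (by linarith)) t.cast_nonneg)
  · have h1 := mul_pos hα (ha t)
    have h2 := mul_pos hβ (hb t)
    have key : ∀ x y : ℝ, 0 < x → 0 < y → y ≤ x →
        Real.log (x + y) / t ≤ Real.log 2 / t + Real.log x / t := fun x y hx hy hxy => by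
      rw [← add_div, ← Real.log_mul two_ne_zero hx.ne']
      exact div_le_div_of_nonneg_right (Real.log_le_log (by linarith) (by linarith)) t.cast_nonneg
    rcases le_total (β * b t) (α * a t) with hle | hle
    · exact (key _ _ h1 h2 hle).trans (add_le_add le_rfl (le_max_left _ _))
    · rw [add_comm (α * a t)]
      exact (key _ _ h2 h1 hle).trans (add_le_add le_rfl (le_max_right _ _))

end LogLimit

/-! ### Path weights under concatenation -/

section PathSums

variable {P : Matrix (Fin 2) (Fin 2) ℝ} {q : Fin 2 → ℝ}

lemma pathWeight_nonneg (hP : ∀ i j, 0 ≤ P i j) (n : ℕ) (i : Fin 2) (x : ℕ → Fin 2) :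
    0 ≤ pathWeight P n i x := by
  induction n generalizing i x with
  | zero => exact zero_le_one
  | succ n ih => exact mul_nonneg (hP _ _) (ih _ _)

/-- Every transition has probability at least `ε`, so restarting from the stationary law loses at
most the factor `ε`, in the first step only. -/
lemma le_pathWeight {ε : ℝ} (hP : ∀ i j, 0 ≤ P i j) (hε : 0 ≤ ε) (hε1 : ε ≤ 1)
    (hεP : ∀ i j, ε ≤ P i j) (hq1 : ∀ i, q i ≤ 1) (hqs : ∑ i, q i = 1)
    (hqP : ∀ j, ∑ i, q i * P i j = q j) (u : ℕ) (i : Fin 2) (y : ℕ → Fin 2) :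
    ε * ∑ j, q j * pathWeight P u j y ≤ pathWeight P u i y := by
  cases u with
  | zero => simpa [pathWeight, hqs] using hε1
  | succ u =>
    simp only [pathWeight, ← mul_assoc]
    rw [← Finset.sum_mul, hqP, ← mul_assoc]
    refine mul_le_mul_of_nonneg_right ?_ (pathWeight_nonneg hP _ _ _)
    exact (mul_le_of_le_one_right hε (hq1 _)).trans (hεP _ _)

lemma le_pathWeight_appendSeq {ε : ℝ} (hP : ∀ i j, 0 ≤ P i j) (hε : 0 ≤ ε) (hε1 : ε ≤ 1)
    (hεP : ∀ i j, ε ≤ P i j) (hq1 : ∀ i, q i ≤ 1) (hqs : ∑ i, q i = 1)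
    (hqP : ∀ j, ∑ i, q i * P i j = q j) (t u : ℕ) (i : Fin 2) (x y : ℕ → Fin 2) :
    ε * (pathWeight P t i x * ∑ j, q j * pathWeight P u j y) ≤
      pathWeight P (t + u) i (appendSeq t x y) := by
  induction t generalizing i x with
  | zero =>
    have h : appendSeq 0 x y = y := by funext k; simp [appendSeq]
    rw [h, Nat.zero_add, pathWeight, one_mul]
    exact le_pathWeight hP hε hε1 hεP hq1 hqs hqP u i y
  | succ t ih =>
    have hx : x = consSeq (x 0) fun k => x (k + 1) := by
      funext k
      cases k <;> rfl
    rw [Nat.add_right_comm, pathWeight, hx, appendSeq_succ_consSeq, pathWeight]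
    simp only [consSeq]
    refine le_trans (le_of_eq ?_) (mul_le_mul_of_nonneg_left
      (ih (x 0) fun k => x (k + 1)) (hP i (x 0)))
    ring

/-- A state with positive mass cannot be left, so only the constant word contributes. -/
lemma sum_pathWeight_of_absorbing (hP : ∀ i, ∑ j, P i j = 1) (i : Fin 2)
    (hq : ∀ j, j ≠ i → q i * P i j = 0) (n : ℕ) {H : (ℕ → Fin 2) → ℝ}
    (hH : ∀ x y, (∀ k < n, x k = y k) → H x = H y) :
    q i * ∑ x : Fin n → Fin 2, pathWeight P n i (word x) * H (word x) =
      q i * H fun _ => i := by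
  induction n generalizing H with
  | zero => simp [pathWeight, hH _ (fun _ => i)]
  | succ n ih =>
    have hii : q i * P i i = q i := by
      rw [← mul_one (q i), mul_assoc, one_mul, ← hP i, Finset.mul_sum,
        Finset.sum_eq_single i (fun j _ hj => hq j hj) (by simp)]
    rw [sum_word_succ n fun x => pathWeight P (n + 1) i x * H x, Finset.mul_sum,
      Finset.sum_eq_single i _ (by simp)]
    · have ih' := ih (H := fun x => H (consSeq i x)) fun x y hxy => hH _ _ fun k hk => by
        cases k with
        | zero => rfl
        | succ k => exact hxy k (by omega)
      have hc : (consSeq i fun _ => i) = fun _ => i := by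
        funext k
        cases k <;> rfl
      rw [hc] at ih'
      rw [← ih']
      simp only [pathWeight, consSeq, mul_assoc]
      rw [← Finset.mul_sum, ← mul_assoc, hii]
    · intro j _ hj
      simp only [pathWeight, consSeq, mul_assoc]
      rw [← Finset.mul_sum, ← mul_assoc, hq j hj, zero_mul]

end PathSums

variable {Ω : Type*} [MeasurableSpace Ω] {μ : Measure Ω}
  {X : ℕ → Ω → Fin 2} {c0 c1 : ℕ → Ω → ℝ≥0} {p01 p10 p θ m : ℝ}

/-! ### Existence of the limit for the window cost -/

section PathMGF

/-- The moment-generating function of `windowCost` along a deterministic path of the chain. -/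
noncomputable def pathMGF (μ : Measure Ω) (c0 c1 : ℕ → Ω → ℝ≥0) (θ : ℝ) (d : ℕ) (w : ℝ≥0)
    (t : ℕ) (x : ℕ → Fin 2) : ℝ :=
  ∫ ω, Real.exp (θ * windowCost d w (modulatedRate (fun k _ => x k) c0 c1 ω) t) ∂μ

lemma pathMGF_congr (d : ℕ) (w : ℝ≥0) (t : ℕ) {x y : ℕ → Fin 2} (hxy : ∀ k < t, x k = y k) :
    pathMGF μ c0 c1 θ d w t x = pathMGF μ c0 c1 θ d w t y := by
  unfold pathMGF
  congr 1
  funext ω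
  rw [windowCost_congr fun k hk => ?_]
  simp only [modulatedRate, hxy k hk]

lemma measurable_modulatedRate_path_pi (h : IsMarkovModulated μ X c0 c1 p01 p10 p)
    (x : ℕ → Fin 2) : Measurable fun ω => modulatedRate (fun k _ => x k) c0 c1 ω :=
  measurable_pi_iff.2 fun k => measurable_modulatedRate_path h x k

variable [IsProbabilityMeasure μ]

lemma pathMGF_pos (h : IsMarkovModulated μ X c0 c1 p01 p10 p) (hθ : 0 < θ) (d : ℕ) (w : ℝ≥0)
    (t : ℕ) (x : ℕ → Fin 2) : 0 < pathMGF μ c0 c1 (-θ) d w t x :=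
  integral_exp_neg_pos hθ
    ((measurable_windowCost d w t).comp (measurable_modulatedRate_path_pi h x))

/-- Along a fixed path the rates of the first `t` and the next `u` slots are independent, and
subadditivity of the cost makes the exponential supermultiplicative. -/
lemma pathMGF_mul_le (h : IsMarkovModulated μ X c0 c1 p01 p10 p) (hθ : 0 < θ) {d : ℕ}
    (hd : 0 < d) (w : ℝ≥0) (t u : ℕ) (z : ℕ → Fin 2) :
    pathMGF μ c0 c1 (-θ) d w t z * pathMGF μ c0 c1 (-θ) d w u (fun k => z (t + k)) ≤
      pathMGF μ c0 c1 (-θ) d w (t + u) z := by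
  have hT : ∀ n, Measurable fun a : ℕ → ℝ≥0 => Real.exp (-θ * windowCost d w a n) := fun n => by
    have := measurable_windowCost d w n
    fun_prop
  have e2 : pathMGF μ c0 c1 (-θ) d w u (fun k => z (t + k)) =
      ∫ ω, Real.exp (-θ * windowCost d w
        (fun k => modulatedRate (fun k _ => z k) c0 c1 ω (t + k)) u) ∂μ :=
    ((identDistrib_modulatedRate_path h z t).comp (hT u)).integral_eq.symm
  -- extend a tuple indexed by a finite set of slots by zeros
  let pad : (S : Finset ℕ) → (S → ℝ≥0) → ℕ → ℝ≥0 := fun S a k =>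
    if hk : k ∈ S then a ⟨k, hk⟩ else 0
  have hpad : ∀ S, Measurable (pad S) := fun S => measurable_pi_iff.2 fun k => by
    by_cases hk : k ∈ S
    · simpa only [pad, hk, dif_pos] using measurable_pi_apply _
    · simp only [pad, hk, dif_neg, not_false_eq_true]
      exact measurable_const
  have hshift : Measurable fun (a : ℕ → ℝ≥0) k => a (t + k) := by fun_prop
  have hind := (iIndepFun_modulatedRate_path h z).indepFun_finset (Finset.range t)
    (Finset.Ico t (t + u)) (Finset.disjoint_left.2 fun k hk hk' =>
      absurd (Finset.mem_range.1 hk) (not_lt.2 (Finset.mem_Ico.1 hk').1))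
    (measurable_modulatedRate_path h z)
  have hprod := (hind.comp ((hT t).comp (hpad _))
    (((hT u).comp hshift).comp (hpad _))).integral_fun_mul_eq_mul_integral
    (((hT t).comp (hpad _)).comp (measurable_pi_iff.2 fun k =>
      measurable_modulatedRate_path h z k)).aestronglyMeasurable
    ((((hT u).comp hshift).comp (hpad _)).comp (measurable_pi_iff.2 fun k =>
      measurable_modulatedRate_path h z k)).aestronglyMeasurable
  have h1 : ∀ ω, windowCost d w (pad (Finset.range t)
      fun i => modulatedRate (fun k _ => z k) c0 c1 ω i) t =
      windowCost d w (modulatedRate (fun k _ => z k) c0 c1 ω) t := fun ω =>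
    windowCost_congr fun k hk => by simp [pad, hk]
  have h2 : ∀ ω, windowCost d w (fun k => pad (Finset.Ico t (t + u))
      (fun i => modulatedRate (fun k _ => z k) c0 c1 ω i) (t + k)) u =
      windowCost d w (fun k => modulatedRate (fun k _ => z k) c0 c1 ω (t + k)) u := fun ω =>
    windowCost_congr fun k hk => by simp [pad, hk]
  simp only [Function.comp_apply, h1, h2] at hprod
  rw [e2, pathMGF, ← hprod, pathMGF]
  have hm := measurable_modulatedRate_path_pi h z
  refine integral_mono ?_ (integrable_exp_neg hθ ((measurable_windowCost d w (t + u)).comp hm))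
    fun ω => ?_
  · refine Integrable.of_bound (C := 1) (((hT t).comp hm).mul
      (((hT u).comp hshift).comp hm)).aestronglyMeasurable (ae_of_all _ fun ω => ?_)
    rw [Real.norm_eq_abs, abs_of_pos (mul_pos (Real.exp_pos _) (Real.exp_pos _))]
    exact mul_le_one₀ (exp_neg_mul_le_one hθ _) (Real.exp_pos _).le (exp_neg_mul_le_one hθ _)
  · beta_reduce
    rw [← Real.exp_add, ← mul_add]
    simp only [neg_mul]
    refine Real.exp_le_exp.2 (neg_le_neg (mul_le_mul_of_nonneg_left ?_ hθ.le))
    exact_mod_cast windowCost_add_le hd t u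

lemma integral_exp_windowCost_eq_sum (h : IsMarkovModulated μ X c0 c1 p01 p10 p) (hθ : 0 < θ)
    (d : ℕ) (w : ℝ≥0) (t : ℕ) :
    ∫ ω, Real.exp (-θ * windowCost d w (modulatedRate X c0 c1 ω) t) ∂μ =
      ∑ i, ![1 - p, p] i * ∑ x : Fin t → Fin 2,
        pathWeight (transitionMatrix p01 p10) t i (word x) *
          pathMGF μ c0 c1 (-θ) d w t (word x) := by
  have hT : Measurable fun a : ℕ → ℝ≥0 => Real.exp (-θ * windowCost d w a t) := by
    have := measurable_windowCost d w t
    fun_prop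
  refine integral_modulatedRate h t hT (C := 1) (fun c => ?_) fun c c' hc => ?_
  · rw [Real.norm_eq_abs, abs_of_pos (Real.exp_pos _)]
    exact exp_neg_mul_le_one hθ _
  · rw [windowCost_congr hc]

lemma exists_tendsto_log_integral_exp_windowCost (h : IsMarkovModulated μ X c0 c1 p01 p10 p)
    (hp01 : 0 ≤ p01) (hp10 : 0 ≤ p10) (hp : p01 + p10 < 1) (hθ : 0 < θ) {d : ℕ} (hd : 0 < d)
    (w : ℝ≥0) :
    ∃ L, Tendsto (fun t : ℕ => Real.log
      (∫ ω, Real.exp (-θ * windowCost d w (modulatedRate X c0 c1 ω) t) ∂μ) / t) atTop (𝓝 L) := by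
  obtain ⟨hp0, hp1⟩ := h.prob_mem
  have hrow : ∀ i, ∑ j, transitionMatrix p01 p10 i j = 1 := fun i => by
    fin_cases i <;> simp [transitionMatrix, Fin.sum_univ_two]
  have hP : ∀ i j, 0 ≤ transitionMatrix p01 p10 i j := fun i j => by
    fin_cases i <;> fin_cases j <;> simp [transitionMatrix] <;> linarith
  have hmeas : ∀ t, Measurable fun ω => windowCost d w (modulatedRate X c0 c1 ω) t := fun t =>
    (measurable_windowCost d w t).comp (measurable_modulatedRate h)
  -- If both are positive, all entries of `P` are at least their minimum, since `p01 + p10 < 1`.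
  -- Otherwise stationarity forces both probability flows to vanish, and the chain is almost surely
  -- constant.
  by_cases hpos : 0 < p01 ∧ 0 < p10
  · set ε := min p01 p10 with hεdef
    have hε : 0 < ε := lt_min hpos.1 hpos.2
    have hεl : ε ≤ p01 := min_le_left _ _
    have hεr : ε ≤ p10 := min_le_right _ _
    have hε1 : ε ≤ 1 := by linarith
    have hεP : ∀ i j, ε ≤ transitionMatrix p01 p10 i j := fun i j => by
      fin_cases i <;> fin_cases j <;> simp [transitionMatrix] <;> linarith
    have hq1 : ∀ i, ![1 - p, p] i ≤ 1 := fun i => by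
      fin_cases i <;> simp <;> linarith
    have hq0 : ∀ i, 0 ≤ ![1 - p, p] i := fun i => by
      fin_cases i <;> simp <;> linarith
    refine exists_tendsto_log_div hε hε1 (fun t => integral_exp_neg_pos hθ (hmeas t))
      (fun t => integral_exp_neg_le_one hθ _) fun t u => ?_
    rw [integral_exp_windowCost_eq_sum h hθ, integral_exp_windowCost_eq_sum h hθ,
      integral_exp_windowCost_eq_sum h hθ]
    have hsum : ∀ i, ∑ x : Fin (t + u) → Fin 2,
        pathWeight (transitionMatrix p01 p10) (t + u) i (word x) *
          pathMGF μ c0 c1 (-θ) d w (t + u) (word x) = _ := fun i =>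
      sum_word_add t u fun x => pathWeight (transitionMatrix p01 p10) (t + u) i x *
        pathMGF μ c0 c1 (-θ) d w (t + u) x
    simp only [hsum]
    have hu : ∑ j, ![1 - p, p] j * ∑ y : Fin u → Fin 2,
        pathWeight (transitionMatrix p01 p10) u j (word y) *
          pathMGF μ c0 c1 (-θ) d w u (word y) =
        ∑ y : Fin u → Fin 2, (∑ j, ![1 - p, p] j *
          pathWeight (transitionMatrix p01 p10) u j (word y)) *
          pathMGF μ c0 c1 (-θ) d w u (word y) := by
      simp only [Finset.mul_sum, Finset.sum_mul, mul_assoc]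
      exact Finset.sum_comm
    rw [hu, Finset.sum_mul, Finset.mul_sum]
    refine Finset.sum_le_sum fun i _ => ?_
    rw [mul_assoc, mul_left_comm]
    refine mul_le_mul_of_nonneg_left ?_ (hq0 i)
    rw [Finset.sum_mul_sum, Finset.mul_sum]
    refine Finset.sum_le_sum fun x _ => ?_
    rw [Finset.mul_sum]
    refine Finset.sum_le_sum fun y _ => ?_
    have e1 := le_pathWeight_appendSeq hP hε.le hε1 hεP hq1
      (by simp [Fin.sum_univ_two]) h.chain.sum_mul_transition t u i (word x) (word y)
    have e2 := pathMGF_mul_le h hθ hd w t u (appendSeq t (word x) (word y))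
    rw [pathMGF_congr (y := word x) d w t fun k hk => by simp [appendSeq, hk],
      pathMGF_congr (x := fun k => appendSeq t (word x) (word y) (t + k)) (y := word y) d w u
        fun k _ => by simp [appendSeq]] at e2
    refine le_trans (le_of_eq ?_) (mul_le_mul e1 e2 (mul_nonneg (pathMGF_pos h hθ d w t _).le
      (pathMGF_pos h hθ d w u _).le) (pathWeight_nonneg hP _ _ _))
    ring
  · have hstat : (1 - p) * p01 = p * p10 := by
      have h1 := h.balance.1
      have h2 := h.balance.2
      linear_combination (1 - p) * h1 - p * h2
    have hoff : (1 - p) * p01 = 0 := by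
      rcases not_and_or.1 hpos with h0 | h0
      · rw [le_antisymm (not_lt.1 h0) hp01, mul_zero]
      · rw [hstat, le_antisymm (not_lt.1 h0) hp10, mul_zero]
    have hq : ∀ i j, j ≠ i → ![1 - p, p] i * transitionMatrix p01 p10 i j = 0 := fun i j hji => by
      fin_cases i <;> fin_cases j <;> simp at hji <;> simp [transitionMatrix]
      · simpa using hoff
      · simpa using hstat.symm.trans hoff
    have hG : ∀ x : ℕ → Fin 2, (∀ t k, x (t + k) = x k) → ∃ L,
        Tendsto (fun t : ℕ => Real.log (pathMGF μ c0 c1 (-θ) d w t x) / t) atTop (𝓝 L) :=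
      fun x hx => by
        refine exists_tendsto_log_div one_pos le_rfl (fun t => pathMGF_pos h hθ d w t x)
          (fun t => integral_exp_neg_le_one hθ _) fun t u => ?_
        have := pathMGF_mul_le h hθ hd w t u x
        simp only [hx] at this
        rwa [one_mul]
    obtain ⟨A, hA⟩ := hG (fun _ => 0) fun _ _ => rfl
    obtain ⟨B, hB⟩ := hG (fun _ => 1) fun _ _ => rfl
    obtain ⟨L, hL⟩ := exists_tendsto_log_add_div (sub_nonneg.2 hp1) hp0 (by ring)
      (fun t => pathMGF_pos h hθ d w t _) (fun t => pathMGF_pos h hθ d w t _) hA hB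
    refine ⟨L, hL.congr fun t => ?_⟩
    have e := fun i => sum_pathWeight_of_absorbing hrow i (hq i) t
      (H := pathMGF μ c0 c1 (-θ) d w t) fun x y hxy => pathMGF_congr d w t hxy
    rw [integral_exp_windowCost_eq_sum h hθ, Finset.sum_congr rfl fun i _ => e i]
    simp [Fin.sum_univ_two]

end PathMGF

/-! ### Effective capacities -/

section EffectiveCapacity

variable [IsProbabilityMeasure μ]

lemma exists_hasEffectiveCapacity_feedbackService
    (h : IsMarkovModulated μ X c0 c1 p01 p10 p)
    (hp01 : 0 ≤ p01) (hp10 : 0 ≤ p10) (hp : p01 + p10 < 1) (hθ : 0 < θ) {d : ℕ} (hd : 0 < d)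
    (w : ℝ≥0) :
    ∃ γ, HasEffectiveCapacity μ
      (fun ω => feedbackService d w (modulatedService X c0 c1 ω)) θ γ := by
  obtain ⟨L, hL⟩ := exists_tendsto_log_integral_exp_windowCost h hp01 hp10 hp hθ hd w
  refine ⟨-(1 / θ) * L, (hL.const_mul (-(1 / θ))).congr fun t => ?_⟩
  rw [bivariateMGF_feedbackService hd w t.zero_le]
  simp only [Nat.zero_add, Nat.sub_zero]
  rw [one_div, one_div, mul_inv]
  ring

/-- Since the limit exists, it can be taken along multiples of `d`, where the floor is exact and the
bound no longer depends on `n`. -/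
lemma le_of_hasEffectiveCapacity_feedbackService
    (h : IsMarkovModulated μ X c0 c1 p01 p10 p)
    (hp01 : 0 ≤ p01) (hp10 : 0 ≤ p10) (hp : p01 + p10 < 1) (hθ : 0 < θ)
    (hm : IsPerronRoot p01 p10 (rateMGF μ c0 c1 (-θ)) m) {d : ℕ} (hd : 0 < d) (w : ℝ≥0) {γ : ℝ}
    (hγ : HasEffectiveCapacity μ
      (fun ω => feedbackService d w (modulatedService X c0 c1 ω)) θ γ) :
    -(1 / (d * θ)) * Real.log (m ^ d + d * Real.exp (-θ * w)) ≤ γ := by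
  have hd' : (0 : ℝ) < d := by exact_mod_cast hd
  have hsub : Tendsto (fun n : ℕ => n * d) atTop atTop :=
    tendsto_id.atTop_mul_const' hd
  refine ge_of_tendsto (hγ.comp hsub) ?_
  filter_upwards [eventually_gt_atTop 0] with n hn
  have hn' : (0 : ℝ) < n := by exact_mod_cast hn
  have hle := bivariateMGF_feedbackService_le h hp01 hp10 hp hθ hm hd w (n * d).zero_le
  have hpos : 0 < bivariateMGF μ (fun ω => feedbackService d w (modulatedService X c0 c1 ω))
      (-θ) 0 (n * d) := by
    rw [bivariateMGF_feedbackService hd w (n * d).zero_le]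
    exact integral_exp_neg_pos hθ ((measurable_windowCost d w _).comp
      (measurable_modulatedRate (h.shift_add 0)))
  rw [Nat.sub_zero, Nat.mul_div_cancel _ hd] at hle
  have hlog := Real.log_le_log hpos hle
  rw [Real.log_pow] at hlog
  simp only [Function.comp_apply, Nat.cast_mul]
  have e : -(1 / (d * θ)) * Real.log (m ^ d + d * Real.exp (-θ * w)) =
      -(1 / (θ * (n * d))) * (n * Real.log (m ^ d + d * Real.exp (-θ * w))) := by
    field_simp
  rw [e]
  refine mul_le_mul_of_nonpos_left hlog (neg_nonpos.2 ?_)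
  positivity

/-- The moment-generating function lies between `κ * m ^ t` and `m ^ t`. Positivity of `κ` needs
mass in both states, because the eigenvector may be supported on only one of them. -/
lemma hasEffectiveCapacity_modulatedService
    (h : IsMarkovModulated μ X c0 c1 p01 p10 p)
    (hp01 : 0 ≤ p01) (hp10 : 0 ≤ p10) (hp : p01 + p10 < 1) (hθ : 0 < θ)
    (hm : IsPerronRoot p01 p10 (rateMGF μ c0 c1 (-θ)) m) (hp0 : 0 < p) (hp1 : p < 1) :
    HasEffectiveCapacity μ (modulatedService X c0 c1) θ (-(1 / θ) * Real.log m) := by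
  have hP : ∀ i j, 0 ≤ transitionMatrix p01 p10 i j := fun i j => by
    fin_cases i <;> fin_cases j <;> simp [transitionMatrix] <;> linarith
  have hq : ∀ i, 0 < ![1 - p, p] i := fun i => by
    fin_cases i <;> simp <;> linarith
  obtain ⟨v, hv0, ⟨i, hi⟩, hv⟩ := exists_le_chainMean hP
    (fun i => (rateMGF_pos h hθ i).le) hm.pos.le hm.isLargest.1
  set κ := ∑ i, ![1 - p, p] i * v i with hκ
  have hκ0 : 0 < κ := Finset.sum_pos' (fun j _ => mul_nonneg (hq j).le (hv0 j))
    ⟨i, Finset.mem_univ i, mul_pos (hq i) hi⟩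
  have hM : ∀ t, bivariateMGF μ (modulatedService X c0 c1) (-θ) 0 t =
      ∫ ω, ∏ k ∈ Finset.range t, Real.exp (-θ * modulatedRate X c0 c1 ω k) ∂μ := fun t => by
    simp only [bivariateMGF, mgf, modulatedService, additiveService, ENNReal.coe_toReal,
      ← Real.exp_sum, ← Finset.mul_sum, Nat.Ico_zero_eq_range, NNReal.coe_sum]
  have hup : ∀ t, bivariateMGF μ (modulatedService X c0 c1) (-θ) 0 t ≤ m ^ t := fun t => by
    rw [hM]
    simpa using integral_prod_le h hp01 hp10 hp hθ hm (Finset.range t)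
  have hlow : ∀ t, m ^ t * κ ≤ bivariateMGF μ (modulatedService X c0 c1) (-θ) 0 t := fun t => by
    have e := integral_prod_modulatedRate h hθ (Finset.range t) t
    have e1 : ∀ ω, (∏ k ∈ Finset.range t, if k ∈ Finset.range t then
        Real.exp (-θ * modulatedRate X c0 c1 ω k) else 1) =
        ∏ k ∈ Finset.range t, Real.exp (-θ * modulatedRate X c0 c1 ω k) := fun ω =>
      Finset.prod_congr rfl fun k hk => if_pos hk
    simp only [e1] at e
    rw [hM, e, hκ, Finset.mul_sum]
    refine Finset.sum_le_sum fun i _ => ?_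
    rw [mul_left_comm]
    refine mul_le_mul_of_nonneg_left ((hv t i).trans_eq ?_) (hq i).le
    exact chainMean_congr (fun k hk => (if_pos (Finset.mem_range.2 hk)).symm) i
  have hlim : Tendsto (fun t : ℕ => -(1 / θ) * Real.log m - 1 / θ * (Real.log κ / t)) atTop
      (𝓝 (-(1 / θ) * Real.log m - 1 / θ * 0)) :=
    tendsto_const_nhds.sub ((tendsto_const_div_atTop_nhds_zero_nat _).const_mul _)
  rw [mul_zero, sub_zero] at hlim
  refine tendsto_of_tendsto_of_tendsto_of_le_of_le' tendsto_const_nhds hlim ?_ ?_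
  · filter_upwards [eventually_gt_atTop 0] with t ht
    have ht' : (0 : ℝ) < t := by exact_mod_cast ht
    have hlog := Real.log_le_log ((mul_pos (pow_pos hm.pos t) hκ0).trans_le (hlow t)) (hup t)
    rw [Real.log_pow] at hlog
    have e : -(1 / θ) * Real.log m = -(1 / (θ * t)) * (t * Real.log m) := by field_simp
    rw [e]
    exact mul_le_mul_of_nonpos_left hlog (neg_nonpos.2 (by positivity))
  · filter_upwards [eventually_gt_atTop 0] with t ht
    have ht' : (0 : ℝ) < t := by exact_mod_cast ht
    have hlog := Real.log_le_log (mul_pos (pow_pos hm.pos t) hκ0) (hlow t)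
    rw [Real.log_mul (pow_pos hm.pos t).ne' hκ0.ne', Real.log_pow] at hlog
    have e : -(1 / θ) * Real.log m - 1 / θ * (Real.log κ / t) =
        -(1 / (θ * t)) * (t * Real.log m + Real.log κ) := by field_simp; ring
    rw [e]
    exact mul_le_mul_of_nonpos_left hlog (neg_nonpos.2 (by positivity))

end EffectiveCapacity

end WindowFlow

theorem corollary4 {Ω : Type*} [MeasurableSpace Ω] (μ : Measure Ω) [IsProbabilityMeasure μ]
    (p01 p10 p : ℝ) (hp01 : 0 ≤ p01) (hp10 : 0 ≤ p10) (hp : p01 + p10 < 1)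
    (X : ℕ → Ω → Fin 2) (c0 c1 : ℕ → Ω → ℝ≥0)
    (hS : WindowFlow.IsMarkovModulated μ X c0 c1 p01 p10 p)
    (d : ℕ) (hd : 0 < d) (w : ℝ≥0) (hw : 0 < w) (θ : ℝ) (hθ : 0 < θ) :
    ∃ m : ℝ,
      WindowFlow.IsLargestEigenvalue (WindowFlow.modulatedMatrix μ c0 c1 p01 p10 (-θ)) m ∧
      0 < m ∧
      (∀ s t : ℕ, s ≤ t →
        WindowFlow.bivariateMGF μ
            (fun ω => WindowFlow.feedbackService d w (WindowFlow.modulatedService X c0 c1 ω))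
            (-θ) s t ≤
          (m ^ d + d * Real.exp (-θ * w)) ^ ((t - s) / d)) ∧
      ∃ γS : ℝ, γS = -(1 / θ) * Real.log m ∧
        (0 < p → p < 1 →
          WindowFlow.HasEffectiveCapacity μ (WindowFlow.modulatedService X c0 c1) θ γS) ∧
        ∃ γwin : ℝ,
          WindowFlow.HasEffectiveCapacity μ
            (fun ω => WindowFlow.feedbackService d w (WindowFlow.modulatedService X c0 c1 ω))
            θ γwin ∧
          γwin ≥ γS - 1 / (d * θ) * Real.log (1 + d * Real.exp (θ * (d * γS - w))) := by
  obtain ⟨m, hm⟩ := WindowFlow.exists_isPerronRoot hp01 hp10 hp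
    (WindowFlow.rateMGF_pos hS hθ) (WindowFlow.rateMGF_le_one hθ)
  obtain ⟨γ, hγ⟩ :=
    WindowFlow.exists_hasEffectiveCapacity_feedbackService hS hp01 hp10 hp hθ hd w
  refine ⟨m, hm.isLargest, hm.pos, fun s t hst =>
    WindowFlow.bivariateMGF_feedbackService_le hS hp01 hp10 hp hθ hm hd w hst, _, rfl,
    WindowFlow.hasEffectiveCapacity_modulatedService hS hp01 hp10 hp hθ hm, γ, hγ, ?_⟩
  refine le_trans (le_of_eq ?_)
    (WindowFlow.le_of_hasEffectiveCapacity_feedbackService hS hp01 hp10 hp hθ hm hd w hγ)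
  have hd' : (d : ℝ) ≠ 0 := by exact_mod_cast hd.ne'
  have hmd : 0 < m ^ d := pow_pos hm.pos d
  -- As `exp (θ d γS) = m ^ (-d)`, the stated bound is the previous one with `m ^ d` factored out of
  -- the logarithm.
  have e1 : Real.exp (θ * (d * (-(1 / θ) * Real.log m) - w)) = Real.exp (-θ * w) / m ^ d := by
    have e : θ * (d * (-(1 / θ) * Real.log m) - w) = -θ * w - d * Real.log m := by
      field_simp
      ring
    rw [e, Real.exp_sub, ← Real.log_pow, Real.exp_log hmd]
  have e2 : 1 + d * (Real.exp (-θ * w) / m ^ d) = (m ^ d + d * Real.exp (-θ * w)) / m ^ d := by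
    field_simp
  have hpos : 0 < m ^ d + d * Real.exp (-θ * w) := by positivity
  rw [e1, e2, Real.log_div hpos.ne' hmd.ne', Real.log_pow]
  field_simp
  ring
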